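/- **Setting.** Let $G=(V,E)$ be a finite simple graph with $n$ nodes and maximum degree $\Delta$; its nodes are the agents. Agent $v$ has a private weight $w(v)\in\{0,1,\dots,W\}$ and submits a bid $b(v)\in\{0,1,\dots,W\}$. A mechanism maps each bid vector $b$ to a set $D(b)\subseteq V$ of selected nodes and payments $p(b)\in\mathbb{R}^V$; the total utility of agent $v$ is $p_v(b)-w(v)$ if $v\in D(b)$ and $p_v(b)$ otherwise. The mechanism is *incentive-compatible* if for every agent, and whatever the other agents bid, bidding $b(v)=w(v)$ maximises the total utility of $v$. In the LOCAL model the nodes compute in synchronous rounds; in each round every node exchanges messages of arbitrary size with its neighbours and updates its state by an arbitrary local computation. Initially node $v$ knows only $W$, its bid $b(v)$ and its identifier; the identifiers are distinct natural numbers of size at most $c\,n^{c}$ for some constant $c$. Each node eventually stops and announces whether $v\in D(b)$ and its payment $p_v(b)$. Let $\log^* n$ be the number of times $\log_2$ must be applied to $n$ to reach a value at most $1$. **Theorem.** There are deterministic LOCAL algorithms, one for each $W\in\{0,1,2,\dots\}$, such that for every $c$ there is a constant $C$ (depending on $c$ only) with the following property. On every graph $G$ with identifiers as above, the algorithm for $W$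 implements a mechanism $b\mapsto(D(b),p(b))$ with: 1. (running time) for every bid vector, all nodes have stopped after at most $C\cdot(\Delta^3W+\max\{1,\log^* n\})$ rounds; 2. (truthfulness) the mechanism is incentive-compatible; 3. (approximation) for every $b$, the set $D(b)$ is dominating (each node is in $D(b)$ or has a neighbour in $D(b)$), and $\sum_{v\in D(b)}b(v)\le(1+\ln(\Delta+1))\sum_{v\in D'}b(v)$ for every dominating set $D'$ of $G$; that is, under truthful bidding it is a $(1+\ln(\Delta+1))$-approximation of minimum-weight dominating set; 4. (monotonicity) if $v\in D(b)$, then $v$ is still selected when it lowers its bid and the other bids remain the same; 5. (greedy allocation) if $W\ge1$, there is a colouring $\phi\colon V\to\mathbb{N}$, not depending on $b$, in which any two distinct nodes within distance $2$ have different colours, such that for every $b$ the set $D(b)$ is the output of the following algorithm. Start with $D=\emptyset$. A node $v$ is active if $D$ does not dominate the whole closed neighbourhood $N^+(v)$, and its ineffectiveness is then $b(v)$ divided by the number of nodes of $N^+(v)$ not dominated by $D$. As long as there are active nodes, add to $D$ simultaneously all active nodes whose ineffectiveness, with ties broken by the smaller colour $\phi$, is smaller than that of every other active node within distance $2$. 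-/

import Mathlib

/-! ### The iterated logarithm -/

/-- The iterated logarithm `log* n`: how often `log₂` has to be applied to `n` until the value is at
most `1`.  (Rounding up after each application of `log₂` does not change this number.) -/
def logStar (n : ℕ) : ℕ :=
  if h : n ≤ 1 then 0 else 1 + logStar (Nat.clog 2 n)
termination_by n
decreasing_by
  have h1 : n - 1 < 2 ^ (n - 1) := Nat.lt_two_pow_self
  have h2 : Nat.clog 2 n ≤ n - 1 := Nat.clog_le_of_le_pow (by omega)
  omega

/-! ### Deterministic algorithms in the LOCAL model -/

/-- A deterministic synchronous message-passing algorithm in the LOCAL model, with local inputs in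
`Input` and local outputs in `Output`.  States and messages are arbitrary types: local computation
and message sizes are unrestricted.  In every round each node sends a message to all its neighbours,
receives the messages of its neighbours, and updates its state.  (A node that wants to tell different
things to different neighbours puts them, labelled with identifiers, into one message.)  A node
*stops* when it reaches a state in which it announces an output; from then on it never changes its
state, hence neither its output. -/
structure LocalAlgorithm (Input Output : Type) where
  State : Type
  Message : Type
  /-- the initial state depends only on the node's own local input -/
  start : Input → State
  /-- the message that a node sends to its neighbours -/
  send : State → Message
  /-- the new state, from the old state and the received messages -/
  receive : State → Multiset Message → State
  /-- the announced output, `none` as long as the node has not stopped -/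
  output : State → Option Output
  stopped : ∀ s msgs, (output s).isSome → receive s msgs = s

namespace LocalAlgorithm

variable {Input Output V : Type} [Fintype V]

/-- The state of every node after `t` communication rounds on the network `G`. -/
def stateAfter (A : LocalAlgorithm Input Output) (G : SimpleGraph V) [DecidableRel G.Adj]
    (input : V → Input) : ℕ → V → A.State
  | 0, v => A.start (input v)
  | t + 1, v => A.receive (A.stateAfter G input t v)
      ((G.neighborFinset v).val.map fun u => A.send (A.stateAfter G input t u))

/-- Within `T` rounds all nodes have stopped, and `out v` is the output of `v`. -/
def ComputesWithin (A : LocalAlgorithm Input Output) (G : SimpleGraph V) [DecidableRel G.Adj]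
    (input : V → Input) (T : ℕ) (out : V → Output) : Prop :=
  ∀ v, A.output (A.stateAfter G input T v) = some (out v)

end LocalAlgorithm

/-! ### Mechanisms for minimum-weight dominating set

Weights and bids are elements of `{0, 1, …, W}`, that is, of `Fin (W + 1)`. -/

/-- What a node knows at the beginning: its identifier and the bid of its agent. -/
structure NodeInput (W : ℕ) where
  id : ℕ
  bid : Fin (W + 1)

/-- What a node announces: whether it is selected, and the payment that its agent receives. -/
structure NodeOutput where
  selected : Bool
  payment : ℝ

/-- The nodes that are selected in an outcome. -/
def selectedSet {V : Type} [Fintype V] (o : V → NodeOutput) : Finset V :=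
  Finset.univ.filter fun v => (o v).selected

/-- The total utility of an agent of true weight `w`: its utility is `-w` if it is selected and `0`
otherwise, and the payment is added to that. -/
noncomputable def totalUtility (w : ℕ) (o : NodeOutput) : ℝ :=
  (if o.selected then -(w : ℝ) else 0) + o.payment

/-- Incentive compatibility of the mechanism that maps a bid vector `b` to the outcome and payments
`mech b`: whatever the bids of the others are, an agent `v` of true weight `b v` maximises its total
utility by bidding `b v`. -/
def IsTruthful {V : Type} [DecidableEq V] {W : ℕ}
    (mech : (V → Fin (W + 1)) → V → NodeOutput) : Prop :=
  ∀ (b : V → Fin (W + 1)) (v : V) (x : Fin (W + 1)),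
    totalUtility (b v : ℕ) (mech (Function.update b v x) v) ≤ totalUtility (b v : ℕ) (mech b v)

/-- Monotonicity for a minimisation problem: a selected agent remains selected when it lowers its
bid. -/
def IsMonotoneMechanism {V : Type} [DecidableEq V] {W : ℕ}
    (mech : (V → Fin (W + 1)) → V → NodeOutput) : Prop :=
  ∀ (b : V → Fin (W + 1)) (v : V) (x : Fin (W + 1)), x ≤ b v →
    (mech b v).selected → (mech (Function.update b v x) v).selected

/-- `D` is a dominating set: every node is in `D` or has a neighbour in `D`. -/
def IsDominatingSet {V : Type} (G : SimpleGraph V) (D : Finset V) : Prop :=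
  ∀ v, v ∈ D ∨ ∃ u ∈ D, G.Adj u v

/-- `D` is an `α`-approximation of minimum-weight dominating set. -/
def IsApproxMinDominatingSet {V : Type} (G : SimpleGraph V) (w : V → ℕ) (α : ℝ) (D : Finset V) :
    Prop :=
  IsDominatingSet G D ∧
    ∀ D' : Finset V, IsDominatingSet G D' → ∑ v ∈ D, (w v : ℝ) ≤ α * ∑ v ∈ D', (w v : ℝ)

/-! ### The greedy algorithm that selects all 2-hop local minima of ineffectiveness -/

section Greedy

variable {V : Type} [Fintype V] [DecidableEq V] (G : SimpleGraph V) [DecidableRel G.Adj]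

/-- The closed neighbourhood `N⁺(v)`. -/
def closedNbhd (v : V) : Finset V := insert v (G.neighborFinset v)

/-- `u` and `v` are distinct nodes at distance at most `2`. -/
abbrev WithinTwo (u v : V) : Prop := u ≠ v ∧ (G.Adj u v ∨ ∃ x, G.Adj u x ∧ G.Adj x v)

/-- The nodes of `N⁺(v)` that the partial dominating set `D` does not cover yet. -/
def uncovered (D : Finset V) (v : V) : Finset V := closedNbhd G v \ D.biUnion (closedNbhd G)

/-- The ineffectiveness of `v`: its weight per newly covered node.  It is used only when
`uncovered G D v` is nonempty. -/
def ineffectiveness (w : V → ℕ) (D : Finset V) (v : V) : ℚ := (w v : ℚ) / (uncovered G D v).card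

/-- `u` comes before `v`: it has smaller ineffectiveness, ties being broken by `φ`. -/
abbrev Precedes (w : V → ℕ) (φ : V → ℕ) (D : Finset V) (u v : V) : Prop :=
  ineffectiveness G w D u < ineffectiveness G w D v ∨
    (ineffectiveness G w D u = ineffectiveness G w D v ∧ φ u < φ v)

/-- The active nodes (those that would cover something new) that come before all other active nodes
within distance `2`. -/
def localMinima (w : V → ℕ) (φ : V → ℕ) (D : Finset V) : Finset V :=
  Finset.univ.filter fun v => (uncovered G D v).Nonempty ∧
    ∀ u, WithinTwo G u v → (uncovered G D u).Nonempty → Precedes G w φ D v u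

/-- The result of the greedy algorithm that starts with `∅` and repeatedly selects all 2-hop local
minima.  As long as there are uncovered nodes each step selects at least one node, so after `|V|`
steps nothing changes any more. -/
def greedyDominatingSet (w : V → ℕ) (φ : V → ℕ) : Finset V :=
  (fun D => D ∪ localMinima G w φ D)^[Fintype.card V] ∅

end Greedy

/-! Greedy selection is confluent. Two local minima are more than two hops apart, so their closed
neighbourhoods are disjoint: selecting one leaves the key (ineffectiveness, colour) of the other
unchanged and can only raise the keys of remaining active nodes (`localMinima_insert`). Hence every
order of selecting local minima ends in the same set (`GreedyReachable.unique`), and the distributed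
algorithm may work asynchronously and with outdated information.

Monotonicity: a run that never selects `v` stays a valid run when `v` raises its bid
(`mem_greedyDominatingSet_of_le`). Truthfulness follows by paying a selected agent its critical bid;
to find it, all executions in which one identifier's bid is replaced are simulated in parallel.
Approximation: the cost of each selection is split among the newly covered nodes, and then N⁺(u)
pays at most a harmonic number times w(u) (`GreedyReachable.exists_price`).

Running time: with O(Δ²) tie-breaking colours there are O(Δ³W) possible keys when Δ, W ≥ 1, keys of
active nodes never decrease, and the minimum key of the active nodes rises within two steps
(`uncovered_eq_empty_of_progress`).

The colouring must be found without knowing n or Δ. Nodes are grouped by the number of nodes within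
distance two, rounded up to a power of two, and the groups use disjoint colour ranges. In a group
with degree bound `D`, colours descend through levels by Linial's polynomial reduction; the level
sizes grow like a tower, so the identifier alone fixes a starting level of O(log* n) for fixed c. At
level 0 an additive process over a prime field ends in O(D) steps
(`LevelColor.number_run_isSome_of_level`). -/

/-! ### Two-hop dynamics -/

/-- A synchronous dynamics in which the new state of a node depends on its own state, on the states
of its neighbours, and on the states of the neighbours of each neighbour.  States that announce an
output are never left. -/
structure TwoHopDynamics (Input Output : Type) where
  State : Type
  start : Input → State
  update : State → Set (State × Set State) → State
  output : State → Option Output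
  output_start : ∀ i, output (start i) = none
  update_of_output : ∀ s N, (output s).isSome → update s N = s

namespace TwoHopDynamics

variable {Input Output V : Type} (P : TwoHopDynamics Input Output)

/-- The states after `t` steps of the dynamics. -/
def run (G : SimpleGraph V) (input : V → Input) : ℕ → V → P.State
  | 0, v => P.start (input v)
  | t + 1, v => P.update (run G input t v)
      ((fun u => (run G input t u, run G input t '' G.neighborSet u)) '' G.neighborSet v)

/-- The state of a node that simulates one step of a two-hop dynamics by two communication rounds:
in the first round it collects the states of its neighbours, in the second round it exchanges the
collected states. -/
@[ext]
structure RelayState (P : TwoHopDynamics Input Output) where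
  collected : Bool
  cur : P.State
  nbrs : Set P.State

open Classical in
/-- A node stops when its own state and those of its neighbours are final. -/
noncomputable def relayOutput (s : P.RelayState) : Option Output :=
  if ∀ x ∈ s.nbrs, (P.output x).isSome then P.output s.cur else none

open Classical in
/-- The message-passing algorithm that simulates a two-hop dynamics. -/
noncomputable def toLocalAlgorithm : LocalAlgorithm Input Output where
  State := P.RelayState
  Message := P.State × Set P.State
  start i := ⟨false, P.start i, ∅⟩
  send s := (s.cur, s.nbrs)
  receive s msgs :=
    if (P.relayOutput s).isSome then s
    else if s.collected then ⟨false, P.update s.cur {m | m ∈ msgs}, s.nbrs⟩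
    else ⟨true, s.cur, {x | ∃ m ∈ msgs, m.1 = x}⟩
  output := P.relayOutput
  stopped _ _ h := if_pos h

variable {P}

lemma relayOutput_isSome {s : P.RelayState} :
    (P.relayOutput s).isSome ↔ (∀ x ∈ s.nbrs, (P.output x).isSome) ∧ (P.output s.cur).isSome := by
  unfold relayOutput
  split_ifs with h
  · exact ⟨fun h' => ⟨h, h'⟩, fun h' => h'.2⟩
  · simp [h]

lemma run_succ_of_output {G : SimpleGraph V} {input : V → Input} {t : ℕ} {v : V}
    (h : (P.output (P.run G input t v)).isSome) :
    P.run G input (t + 1) v = P.run G input t v :=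
  P.update_of_output _ _ h

variable [Fintype V]

/-- The invariant of the simulation. A node that stops freezes its stored `nbrs` too, yet keeps
sending correct messages: it stops only when all stored states are final, and these no longer
change. -/
lemma stateAfter_toLocalAlgorithm (G : SimpleGraph V) [DecidableRel G.Adj] (input : V → Input)
    (t : ℕ) :
    (∀ v, (P.toLocalAlgorithm.stateAfter G input (2 * t) v).cur = P.run G input t v ∧
      (P.toLocalAlgorithm.stateAfter G input (2 * t) v).nbrs =
        (if t = 0 then ∅ else P.run G input (t - 1) '' G.neighborSet v) ∧
      (¬ (P.relayOutput (P.toLocalAlgorithm.stateAfter G input (2 * t) v)).isSome →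
        (P.toLocalAlgorithm.stateAfter G input (2 * t) v).collected = false)) ∧
    (∀ v, (P.toLocalAlgorithm.stateAfter G input (2 * t + 1) v).cur = P.run G input t v ∧
      (P.toLocalAlgorithm.stateAfter G input (2 * t + 1) v).nbrs =
        P.run G input t '' G.neighborSet v ∧
      (¬ (P.relayOutput (P.toLocalAlgorithm.stateAfter G input (2 * t + 1) v)).isSome →
        (P.toLocalAlgorithm.stateAfter G input (2 * t + 1) v).collected = true)) := by
  have odd : ∀ t, (∀ v, (P.toLocalAlgorithm.stateAfter G input (2 * t) v).cur = P.run G input t v ∧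
      (P.toLocalAlgorithm.stateAfter G input (2 * t) v).nbrs =
        (if t = 0 then ∅ else P.run G input (t - 1) '' G.neighborSet v) ∧
      (¬ (P.relayOutput (P.toLocalAlgorithm.stateAfter G input (2 * t) v)).isSome →
        (P.toLocalAlgorithm.stateAfter G input (2 * t) v).collected = false)) →
    (∀ v, (P.toLocalAlgorithm.stateAfter G input (2 * t + 1) v).cur = P.run G input t v ∧
      (P.toLocalAlgorithm.stateAfter G input (2 * t + 1) v).nbrs =
        P.run G input t '' G.neighborSet v ∧
      (¬ (P.relayOutput (P.toLocalAlgorithm.stateAfter G input (2 * t + 1) v)).isSome →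
        (P.toLocalAlgorithm.stateAfter G input (2 * t + 1) v).collected = true)) := by
    intro t ih v
    obtain ⟨h1, h2, h3⟩ := ih v
    have hs : P.toLocalAlgorithm.stateAfter G input (2 * t + 1) v =
      P.toLocalAlgorithm.receive (P.toLocalAlgorithm.stateAfter G input (2 * t) v)
      ((G.neighborFinset v).val.map fun u =>
        P.toLocalAlgorithm.send (P.toLocalAlgorithm.stateAfter G input (2 * t) u)) := rfl
    by_cases hst : (P.relayOutput (P.toLocalAlgorithm.stateAfter G input (2 * t) v)).isSome
    · rw [P.toLocalAlgorithm.stopped _ _ hst] at hs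
      rw [hs]
      refine ⟨h1, ?_, fun h => absurd hst h⟩
      obtain ⟨h4, h5⟩ := relayOutput_isSome.1 hst
      -- At time 0 nothing has been collected, so only `output_start` rules out a premature stop.
      rcases t with _ | t
      · rw [h1] at h5
        simp [run, P.output_start] at h5
      · rw [h2] at h4 ⊢
        simp only [Nat.add_eq_zero_iff, one_ne_zero, and_false, if_false,
          Nat.add_sub_cancel] at h4 ⊢
        refine Set.image_congr fun u hu => ?_
        exact (run_succ_of_output (h4 _ ⟨u, hu, rfl⟩)).symm
    · have : P.toLocalAlgorithm.stateAfter G input (2 * t + 1) v =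
          ⟨true, P.run G input t v, P.run G input t '' G.neighborSet v⟩ := by
        refine hs.trans ((if_neg hst).trans ((if_neg (by simp [h3 hst])).trans
          (RelayState.ext rfl h1 ?_)))
        ext x
        constructor
        · rintro ⟨_, hm, rfl⟩
          obtain ⟨u, hu, rfl⟩ := Multiset.mem_map.1 hm
          exact ⟨u, by simpa using hu, (ih u).1.symm⟩
        · rintro ⟨u, hu, rfl⟩
          exact ⟨_, Multiset.mem_map.2 ⟨u, by simpa using hu, rfl⟩, (ih u).1⟩
      rw [this]
      exact ⟨rfl, rfl, fun _ => rfl⟩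
  induction t with
  | zero =>
    have h0 : ∀ v, (P.toLocalAlgorithm.stateAfter G input (2 * 0) v).cur = P.run G input 0 v ∧
      (P.toLocalAlgorithm.stateAfter G input (2 * 0) v).nbrs =
        (if 0 = 0 then ∅ else P.run G input (0 - 1) '' G.neighborSet v) ∧
      (¬ (P.relayOutput (P.toLocalAlgorithm.stateAfter G input (2 * 0) v)).isSome →
        (P.toLocalAlgorithm.stateAfter G input (2 * 0) v).collected = false) :=
      fun v => ⟨rfl, rfl, fun _ => rfl⟩
    exact ⟨h0, odd 0 h0⟩
  | succ t ih =>
    refine (fun h => ⟨h, odd (t + 1) h⟩) fun v => ?_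
    replace ih := ih.2
    obtain ⟨h1, h2, h3⟩ := ih v
    have hs : P.toLocalAlgorithm.stateAfter G input (2 * (t + 1)) v =
      P.toLocalAlgorithm.receive (P.toLocalAlgorithm.stateAfter G input (2 * t + 1) v)
      ((G.neighborFinset v).val.map fun u =>
        P.toLocalAlgorithm.send (P.toLocalAlgorithm.stateAfter G input (2 * t + 1) u)) := rfl
    simp only [Nat.add_eq_zero_iff, one_ne_zero, and_false, if_false, Nat.add_sub_cancel]
    by_cases hst : (P.relayOutput (P.toLocalAlgorithm.stateAfter G input (2 * t + 1) v)).isSome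
    · rw [P.toLocalAlgorithm.stopped _ _ hst] at hs
      rw [hs]
      refine ⟨?_, h2, fun h => absurd hst h⟩
      obtain ⟨h4, h5⟩ := relayOutput_isSome.1 hst
      rw [h1] at h5 ⊢
      exact (run_succ_of_output h5).symm
    · have : P.toLocalAlgorithm.stateAfter G input (2 * (t + 1)) v =
          ⟨false, P.run G input (t + 1) v, P.run G input t '' G.neighborSet v⟩ := by
        refine hs.trans ((if_neg hst).trans ((if_pos (h3 hst)).trans
          (RelayState.ext rfl (congrArg₂ P.update h1 ?_) h2)))
        ext x
        constructor
        · intro hm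
          obtain ⟨u, hu, rfl⟩ := Multiset.mem_map.1 hm
          exact ⟨u, by simpa using hu, Prod.ext (ih u).1.symm (ih u).2.1.symm⟩
        · rintro ⟨u, hu, rfl⟩
          exact Multiset.mem_map.2 ⟨u, by simpa using hu, Prod.ext (ih u).1 (ih u).2.1⟩
      rw [this]
      exact ⟨rfl, rfl, fun _ => rfl⟩

/-- If the two-hop dynamics has reached final states after `T` steps, then the simulating algorithm
has stopped after `2 * T + 1` rounds. -/
theorem computesWithin_toLocalAlgorithm {G : SimpleGraph V} [DecidableRel G.Adj]
    {input : V → Input} {T R : ℕ} {out : V → Output}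
    (h : ∀ v, P.output (P.run G input T v) = some (out v)) (hR : 2 * T + 1 ≤ R) :
    P.toLocalAlgorithm.ComputesWithin G input R out := by
  intro v
  -- The extra round delivers the final states of the neighbours.
  have base : P.relayOutput (P.toLocalAlgorithm.stateAfter G input (2 * T + 1) v) =
      some (out v) := by
    obtain ⟨h1, h2, -⟩ := (stateAfter_toLocalAlgorithm (P := P) G input T).2 v
    unfold relayOutput
    rw [h1, h2, if_pos, h]
    rintro _ ⟨u, -, rfl⟩
    simp [h]
  obtain ⟨k, rfl⟩ := Nat.exists_eq_add_of_le hR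
  have : ∀ k, P.toLocalAlgorithm.stateAfter G input (2 * T + 1 + k) v =
      P.toLocalAlgorithm.stateAfter G input (2 * T + 1) v := by
    intro k
    induction k with
    | zero => rfl
    | succ k ih =>
      rw [← Nat.add_assoc, LocalAlgorithm.stateAfter, P.toLocalAlgorithm.stopped, ih]
      rw [ih]
      change (P.relayOutput _).isSome
      rw [base]
      rfl
  change P.relayOutput _ = _
  rw [this, base]

end TwoHopDynamics

/-! ### Towers of exponentials -/

/-- The tower of `i` twos. -/
def expTower : ℕ → ℕ
  | 0 => 1
  | i + 1 => 2 ^ expTower i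

lemma le_expTower_logStar (n : ℕ) : n ≤ expTower (logStar n) := by
  induction n using Nat.strong_induction_on with
  | _ n ih =>
    rw [logStar]
    split_ifs with h
    · exact h
    · have h1 : n - 1 < 2 ^ (n - 1) := Nat.lt_two_pow_self
      have h2 : Nat.clog 2 n ≤ n - 1 := Nat.clog_le_of_le_pow (by omega)
      rw [Nat.add_comm, expTower]
      exact (Nat.le_pow_clog one_lt_two n).trans
        (Nat.pow_le_pow_right two_pos (ih _ (by omega)))

lemma expTower_add_le (i c : ℕ) : expTower i + c ≤ expTower (i + c) := by
  induction c with
  | zero => rfl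
  | succ c ih =>
    have : expTower (i + c) < 2 ^ expTower (i + c) := Nat.lt_two_pow_self
    change _ ≤ 2 ^ expTower (i + c)
    omega

lemma mul_pow_le_expTower (c n : ℕ) : c * n ^ c ≤ expTower (logStar n + c + 2) := by
  set x := expTower (logStar n)
  have hn : n ≤ x := le_expTower_logStar n
  have hc : c < 2 ^ c := Nat.lt_two_pow_self
  have hx : x < 2 ^ x := Nat.lt_two_pow_self
  calc c * n ^ c ≤ 2 ^ c * (2 ^ x) ^ c :=
        Nat.mul_le_mul hc.le (Nat.pow_le_pow_left (hn.trans hx.le) c)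
    _ = 2 ^ (c * (x + 1)) := by rw [← pow_mul, ← pow_add]; ring_nf
    _ ≤ 2 ^ (2 ^ c * 2 ^ x) := Nat.pow_le_pow_right two_pos (Nat.mul_le_mul hc.le hx)
    _ = 2 ^ 2 ^ (x + c) := by rw [← pow_add, Nat.add_comm]
    _ ≤ 2 ^ 2 ^ expTower (logStar n + c) :=
        Nat.pow_le_pow_right two_pos (Nat.pow_le_pow_right two_pos (expTower_add_le _ _))

/-! ### A rapidly growing sequence of primes -/

/-- A prime number in the interval `(n, 2 * n]` if `n ≠ 0`. -/
noncomputable def primeAbove (n : ℕ) : ℕ :=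
  if h : n ≠ 0 then (Nat.exists_prime_lt_and_le_two_mul n h).choose else 2

lemma primeAbove_prime (n : ℕ) : (primeAbove n).Prime := by
  unfold primeAbove
  split_ifs with h
  · exact (Nat.exists_prime_lt_and_le_two_mul n h).choose_spec.1
  · exact Nat.prime_two

lemma lt_primeAbove (n : ℕ) : n < primeAbove n := by
  unfold primeAbove
  split_ifs with h
  · exact (Nat.exists_prime_lt_and_le_two_mul n h).choose_spec.2.1
  · omega

lemma primeAbove_le {n : ℕ} (h : n ≠ 0) : primeAbove n ≤ 2 * n := by
  unfold primeAbove
  rw [dif_pos h]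
  exact (Nat.exists_prime_lt_and_le_two_mul n h).choose_spec.2.2

/-- The field sizes of the colour levels for degree bound `D`. -/
noncomputable def levelPrime (D : ℕ) : ℕ → ℕ
  | 0 => primeAbove (16 * D)
  -- Subtracting 4 leaves room in `exists_free_point` for two more forbidden points per neighbour
  -- beyond the agreements.
  | j + 1 => primeAbove (levelPrime D j ^ ((levelPrime D j / D - 4) / 2))

lemma levelPrime_prime (D j : ℕ) : (levelPrime D j).Prime := by
  cases j <;> exact primeAbove_prime _

instance (D j : ℕ) : Fact (levelPrime D j).Prime := ⟨levelPrime_prime D j⟩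

/-- The factor 16 makes the exponent in `levelPrime` at least (16 - 4) / 2 = 6. -/
lemma lt_levelPrime {D : ℕ} (hD : 0 < D) (j : ℕ) :
    16 * D < levelPrime D j ∧ levelPrime D j ^ 6 < levelPrime D (j + 1) := by
  have key : ∀ j, 16 * D < levelPrime D j → levelPrime D j ^ 6 < levelPrime D (j + 1) := by
    intro j h
    refine lt_of_le_of_lt ?_ (lt_primeAbove _)
    refine Nat.pow_le_pow_right (levelPrime_prime D j).pos ?_
    have : 16 ≤ levelPrime D j / D := (Nat.le_div_iff_mul_le hD).2 h.le
    omega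
  have base : 16 * D < levelPrime D j := by
    induction j with
    | zero => exact lt_primeAbove _
    | succ j ih =>
      exact ih.trans_le ((Nat.le_self_pow (by norm_num) _).trans (key j ih).le)
  exact ⟨base, key j base⟩

/-- The exponent used at level `j + 2` is about `q / (2 * D)`, which exceeds `p` because `q > p ^ 6`
and `p > 16 * D`. So two levels climb one exponential, which bounds starting levels by twice a tower
height. -/
lemma two_pow_lt_levelPrime {D : ℕ} (hD : 0 < D) (j : ℕ) :
    2 ^ levelPrime D j < levelPrime D (j + 2) := by
  obtain ⟨h1, h2⟩ := lt_levelPrime hD j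
  set p := levelPrime D j
  set q := levelPrime D (j + 1) with hq
  have hp : 16 ≤ p := by omega
  have hq2 : 2 ≤ q := (levelPrime_prime D (j + 1)).two_le
  have h3 : p ^ 5 ≤ q / D := by
    rw [Nat.le_div_iff_mul_le hD]
    calc p ^ 5 * D ≤ p ^ 5 * p := Nat.mul_le_mul_left _ (by omega)
      _ = p ^ 6 := by ring
      _ ≤ q := h2.le
  have h4 : 16 ^ 4 * p ≤ p ^ 5 := by
    calc 16 ^ 4 * p ≤ p ^ 4 * p := Nat.mul_le_mul_right _ (Nat.pow_le_pow_left hp 4)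
      _ = p ^ 5 := by ring
  refine lt_of_le_of_lt ?_ (lt_primeAbove _)
  rw [← hq]
  exact (Nat.pow_le_pow_left hq2 p).trans (Nat.pow_le_pow_right (by omega) (by omega))

lemma expTower_lt_levelPrime {D : ℕ} (hD : 0 < D) (i : ℕ) : expTower i < levelPrime D (2 * i) := by
  induction i with
  | zero => exact lt_of_le_of_lt (by change 1 ≤ 16 * D; omega) (lt_levelPrime hD 0).1
  | succ i ih =>
    exact (Nat.pow_le_pow_right two_pos ih.le).trans_lt (two_pow_lt_levelPrime hD (2 * i))

/-! ### Functions with few agreements -/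

/-- Polynomials of degree at most `k` over `ZMod p` give `p ^ (k + 1)` functions that agree pairwise
in at most `k` points. -/
lemma exists_few_agreements (p k : ℕ) [Fact p.Prime] {α : Type} [Fintype α]
    (h : Fintype.card α ≤ p ^ (k + 1)) :
    ∃ g : α → ZMod p → ZMod p, ∀ x y, x ≠ y →
      (Finset.univ.filter fun a => g x a = g y a).card ≤ k := by
  classical
  obtain ⟨e⟩ : Nonempty (α ↪ (Fin (k + 1) → ZMod p)) := by
    apply Function.Embedding.nonempty_of_card_le
    simpa [ZMod.card] using h
  let f : α → Polynomial (ZMod p) := fun x =>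
    ((Polynomial.degreeLTEquiv (ZMod p) (k + 1)).symm (e x) : Polynomial (ZMod p))
  refine ⟨fun x a => (f x).eval a, fun x y hxy => ?_⟩
  have hne : f x - f y ≠ 0 := by
    intro h0
    refine hxy (e.injective ((Polynomial.degreeLTEquiv (ZMod p) (k + 1)).symm.injective ?_))
    exact Subtype.ext (sub_eq_zero.1 h0)
  have hmem : f x - f y ∈ Polynomial.degreeLT (ZMod p) (k + 1) :=
    Submodule.sub_mem _ (Subtype.prop _) (Subtype.prop _)
  have hdeg : (f x - f y).natDegree ≤ k := by
    rw [Polynomial.mem_degreeLT] at hmem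
    have := (Polynomial.natDegree_lt_iff_degree_lt hne).2 hmem
    omega
  calc _ ≤ (f x - f y).roots.toFinset.card := by
        refine Finset.card_le_card fun a ha => ?_
        rw [Multiset.mem_toFinset, Polynomial.mem_roots hne, Polynomial.IsRoot,
          Polynomial.eval_sub, sub_eq_zero]
        simpa using ha
    _ ≤ Multiset.card (f x - f y).roots := Multiset.toFinset_card_le _
    _ ≤ k := (Polynomial.card_roots' _).trans hdeg

/-! ### Colour reduction with unknown number of nodes -/

/-- The colours for degree bound `D`: a colour of level `j` is a pair of elements of a field with
`levelPrime D j` elements. -/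
abbrev LevelColor (D : ℕ) : Type := Σ j, ZMod (levelPrime D j) × ZMod (levelPrime D j)

/-- Since the next prime is at most 2pᵐ, the next level has at most 4p²ᵐ ≤ p²ᵐ⁺² colours, as many as
there are polynomials of degree at most 2m + 1 over the current field. -/
lemma exists_separator (D j : ℕ) :
    ∃ g : ZMod (levelPrime D (j + 1)) × ZMod (levelPrime D (j + 1)) →
        ZMod (levelPrime D j) → ZMod (levelPrime D j), ∀ x y, x ≠ y →
      (Finset.univ.filter fun a => g x a = g y a).card ≤
        2 * ((levelPrime D j / D - 4) / 2) + 1 := by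
  apply exists_few_agreements
  set p := levelPrime D j with hp
  set m := (p / D - 4) / 2 with hm
  have h1 : levelPrime D (j + 1) ≤ 2 * p ^ m :=
    primeAbove_le (pow_ne_zero _ (levelPrime_prime D j).ne_zero)
  have h2 : 2 ≤ p := (levelPrime_prime D j).two_le
  rw [Fintype.card_prod, ZMod.card]
  calc _ ≤ (2 * p ^ m) * (2 * p ^ m) := Nat.mul_le_mul h1 h1
    _ ≤ (p * p ^ m) * (p * p ^ m) := by gcongr
    _ = p ^ (2 * m + 1 + 1) := by ring

/-- The functions that encode the colours of level `j + 1`. -/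
noncomputable def separator (D j : ℕ) :
    ZMod (levelPrime D (j + 1)) × ZMod (levelPrime D (j + 1)) →
      ZMod (levelPrime D j) → ZMod (levelPrime D j) :=
  (exists_separator D j).choose

variable {D : ℕ}

namespace LevelColor

/-- The colour after a conflict at level `0`. -/
noncomputable def move : LevelColor D → LevelColor D
  | ⟨0, x⟩ => ⟨0, x.1, x.2 + x.1⟩
  | s => s

/-- The colour that a node of level `0` keeps if it has no conflict. -/
noncomputable def halt : LevelColor D → LevelColor D
  | ⟨0, x⟩ => ⟨0, 0, x.2⟩
  | s => s

open Classical in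
/-- One step of the colour reduction, `N` being the set of colours of the neighbours.  At positive
levels a node picks a point on the graph of its function that is not on the graphs of the functions
of its neighbours and is not a possible next colour of a neighbour of level `0`. -/
noncomputable def step : LevelColor D → Set (LevelColor D) → LevelColor D
  -- Conflicts at level 0 concern only neighbours at level 0; nodes arriving from level 1 do the
  -- avoiding themselves.
  | ⟨0, x⟩, N => if ∃ y, (⟨0, y⟩ : LevelColor D) ∈ N ∧ y.2 = x.2 then move ⟨0, x⟩ else halt ⟨0, x⟩
  | ⟨j + 1, x⟩, N => ⟨j,
      if h : ∃ a, (∀ y, (⟨j + 1, y⟩ : LevelColor D) ∈ N → separator D j x a ≠ separator D j y a) ∧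
        ∀ s ∈ N, (⟨j, a, separator D j x a⟩ : LevelColor D) ≠ move s ∧
          (⟨j, a, separator D j x a⟩ : LevelColor D) ≠ halt s
      -- The default is never used when the colouring is proper and there are at most `D`
      -- neighbours, by `exists_free_point`.
      then (h.choose, separator D j x h.choose) else 0⟩

/-- The colour of level `j` with number `i`. -/
noncomputable def ofNat (D j i : ℕ) : LevelColor D := ⟨j, (i / levelPrime D j : ℕ), i⟩

/-- The colour of the identifier `i`. -/
noncomputable def init (D i : ℕ) : LevelColor D :=
  ofNat D (sInf {j | i < levelPrime D j ^ 2}) i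

open Classical in
/-- The number of a final colour; the numbers for different powers of two `D` are different. -/
noncomputable def number : LevelColor D → Option ℕ
  | ⟨0, x⟩ => if x.1 = 0 then some (32 * D + x.2.val) else none
  | _ => none

lemma number_eq_some {s : LevelColor D} {c : ℕ} (h : s.number = some c) :
    ∃ b, s = ⟨0, 0, b⟩ ∧ c = 32 * D + b.val := by
  obtain ⟨_ | j, a, b⟩ := s
  · simp only [number] at h
    split_ifs at h with h0
    · subst h0
      exact ⟨b, rfl, (Option.some.inj h).symm⟩
  · simp [number] at h

lemma number_bounds (hD : 0 < D) {s : LevelColor D} {c : ℕ} (h : s.number = some c) :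
    32 * D ≤ c ∧ c < 64 * D := by
  obtain ⟨b, rfl, rfl⟩ := number_eq_some h
  have h1 : levelPrime D 0 ≤ 2 * (16 * D) := primeAbove_le (by omega)
  have h2 : b.val < levelPrime D 0 := ZMod.val_lt b
  omega

lemma number_injOn {s s' : LevelColor D} {c : ℕ} (h : s.number = some c)
    (h' : s'.number = some c) : s = s' := by
  obtain ⟨b, rfl, hb⟩ := number_eq_some h
  obtain ⟨b', rfl, hb'⟩ := number_eq_some h'
  rw [ZMod.val_injective _ (by omega : b.val = b'.val)]

lemma step_of_number {s : LevelColor D} (h : s.number.isSome) (N : Set (LevelColor D)) :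
    s.step N = s := by
  obtain ⟨c, h⟩ := Option.isSome_iff_exists.1 h
  obtain ⟨b, rfl, -⟩ := number_eq_some h
  simp [step, move, halt]

lemma step_fst (s : LevelColor D) (N : Set (LevelColor D)) : (s.step N).1 = s.1 - 1 := by
  obtain ⟨_ | j, x⟩ := s
  · simp only [step]
    split_ifs <;> rfl
  · rfl

lemma init_level_mem (hD : 0 < D) (i : ℕ) : i < levelPrime D (init D i).1 ^ 2 := by
  have : (sInf {j | i < levelPrime D j ^ 2}) ∈ {j | i < levelPrime D j ^ 2} := by
    apply Nat.sInf_mem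
    refine ⟨2 * i, ?_⟩
    have h1 : i ≤ expTower i := by simpa using (Nat.le_add_left _ _).trans (expTower_add_le 0 i)
    exact (h1.trans_lt (expTower_lt_levelPrime hD i)).trans_le (Nat.le_self_pow two_ne_zero _)
  exact this

/-- An identifier below p² is recovered from its quotient and remainder modulo p. -/
lemma init_injective (hD : 0 < D) : Function.Injective (init D) := by
  intro i i' h
  have h1 := init_level_mem hD i
  have h2 := init_level_mem hD i'
  unfold init at h h1 h2
  generalize sInf {j | i < levelPrime D j ^ 2} = j at h h1
  generalize sInf {j | i' < levelPrime D j ^ 2} = j' at h h2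
  obtain rfl : j = j' := congrArg Sigma.fst h
  simp only [ofNat] at h1 h2
  simp only [ofNat, Sigma.mk.injEq, heq_eq_eq, true_and, Prod.mk.injEq] at h
  obtain ⟨h3, h4⟩ := h
  rw [ZMod.natCast_eq_natCast_iff'] at h3 h4
  rw [pow_two] at h1 h2
  rw [Nat.mod_eq_of_lt (Nat.div_lt_of_lt_mul h1), Nat.mod_eq_of_lt (Nat.div_lt_of_lt_mul h2)] at h3
  rw [← Nat.div_add_mod i (levelPrime D j), h3, h4, Nat.div_add_mod]

lemma init_level_le (hD : 0 < D) {i c n : ℕ} (h : i ≤ c * n ^ c) :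
    (init D i).1 ≤ 2 * (logStar n + c + 2) := by
  apply Nat.sInf_le
  have h1 := h.trans (mul_pow_le_expTower c n)
  exact (h1.trans_lt (expTower_lt_levelPrime hD _)).trans_le (Nat.le_self_pow two_ne_zero _)

/-- A node of positive level finds a good point if it has at most `D` neighbours. -/
lemma exists_free_point (hD : 0 < D) {N : Set (LevelColor D)} (hfin : N.Finite)
    (hN : N.ncard ≤ D) {j : ℕ} {x : ZMod (levelPrime D (j + 1)) × ZMod (levelPrime D (j + 1))}
    (hx : (⟨j + 1, x⟩ : LevelColor D) ∉ N) :
    ∃ a, (∀ y, (⟨j + 1, y⟩ : LevelColor D) ∈ N → separator D j x a ≠ separator D j y a) ∧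
        ∀ s ∈ N, (⟨j, a, separator D j x a⟩ : LevelColor D) ≠ move s ∧
          (⟨j, a, separator D j x a⟩ : LevelColor D) ≠ halt s := by
  classical
  set p := levelPrime D j
  set k := 2 * ((p / D - 4) / 2) + 1 with hk
  lift N to Finset (LevelColor D) using hfin
  rw [Set.ncard_coe_finset] at hN
  simp only [Finset.mem_coe] at hx ⊢
  let pt : ZMod p → LevelColor D := fun a => ⟨j, a, separator D j x a⟩
  have hpt : Function.Injective pt := by
    intro a a' h
    simp only [pt, Sigma.mk.injEq, heq_eq_eq, true_and, Prod.mk.injEq] at h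
    exact h.1
  let bad : LevelColor D → Finset (ZMod p) := fun s =>
    (Finset.univ.filter fun a => ∃ y, s = ⟨j + 1, y⟩ ∧ separator D j x a = separator D j y a) ∪
      ((Finset.univ.filter fun a => pt a = move s) ∪ (Finset.univ.filter fun a => pt a = halt s))
  have hone : ∀ s, (Finset.univ.filter fun a => pt a = s).card ≤ 1 := by
    intro s
    refine Finset.card_le_one.2 fun a ha b hb => hpt ?_
    simp only [Finset.mem_filter] at ha hb
    rw [ha.2, hb.2]
  have hbad : ∀ s ∈ N, (bad s).card ≤ k + 2 := by
    intro s hs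
    refine (Finset.card_union_le _ _).trans (add_le_add ?_
      ((Finset.card_union_le _ _).trans (add_le_add (hone _) (hone _))))
    by_cases h : ∃ y, s = ⟨j + 1, y⟩
    · obtain ⟨y, rfl⟩ := h
      have hxy : x ≠ y := by
        rintro rfl
        exact hx hs
      refine (Finset.card_le_card fun a ha => ?_).trans ((exists_separator D j).choose_spec x y hxy)
      simp only [Finset.mem_filter, Finset.mem_univ, true_and] at ha ⊢
      obtain ⟨y', hy', h⟩ := ha
      simp only [Sigma.mk.injEq, heq_eq_eq, true_and] at hy'
      subst hy'
      exact h
    · rw [Finset.card_eq_zero.2]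
      · exact Nat.zero_le _
      · ext a
        simp only [Finset.mem_filter, Finset.mem_univ, true_and, Finset.notMem_empty, iff_false]
        rintro ⟨y, hy, -⟩
        exact h ⟨y, hy⟩
  -- Each of at most `D` neighbours forbids at most `k` agreements and one point each for `move` and
  -- `halt`, and `k + 2 < p / D`.
  have hcard : (N.biUnion bad).card < p := by
    have h1 : (N.biUnion bad).card ≤ N.card * (k + 2) := Finset.card_biUnion_le_card_mul _ _ _ hbad
    have h2 : 16 ≤ p / D := (Nat.le_div_iff_mul_le hD).2 (lt_levelPrime hD j).1.le
    have h3 : k + 2 < p / D := by omega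
    have h4 : (p / D) * D ≤ p := Nat.div_mul_le_self _ _
    nlinarith
  obtain ⟨a, ha⟩ : ∃ a, a ∉ N.biUnion bad := by
    by_contra! h
    have : (N.biUnion bad) = Finset.univ := Finset.eq_univ_iff_forall.2 h
    rw [this, Finset.card_univ, ZMod.card] at hcard
    exact lt_irrefl _ hcard
  simp only [Finset.mem_biUnion, not_exists, not_and] at ha
  refine ⟨a, fun y hy h => ha _ hy ?_, fun s hs => ⟨fun h => ha s hs ?_, fun h => ha s hs ?_⟩⟩
  · exact Finset.mem_union_left _ (Finset.mem_filter.2 ⟨Finset.mem_univ _, y, rfl, h⟩)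
  · exact Finset.mem_union_right _ (Finset.mem_union_left _ (by simpa [pt] using h))
  · exact Finset.mem_union_right _ (Finset.mem_union_right _ (by simpa [pt] using h))

/-- Adjacent nodes with different colours still have different colours after one step. -/
lemma step_ne_step (hD : 0 < D) {M N : Set (LevelColor D)} (hM : M.Finite) (hM' : M.ncard ≤ D)
    (hN : N.Finite) (hN' : N.ncard ≤ D) {r s : LevelColor D} (hr : r ∉ M) (hs : s ∉ N)
    (hrN : r ∈ N) (hsM : s ∈ M) : r.step M ≠ s.step N := by
  have hrs : r ≠ s := fun h => hr (h ▸ hsM)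
  have zero_step : ∀ (x) (M : Set (LevelColor D)), step ⟨0, x⟩ M = move ⟨0, x⟩ ∨
      step ⟨0, x⟩ M = halt ⟨0, x⟩ := by
    intro x M
    simp only [step]
    split_ifs <;> simp
  -- A level-0 node either moves or halts, and its descending neighbour has avoided both possible
  -- results.
  have mixed : ∀ (M N : Set (LevelColor D)) (x) (i) (y), N.Finite → N.ncard ≤ D →
      (⟨i + 1, y⟩ : LevelColor D) ∉ N → (⟨0, x⟩ : LevelColor D) ∈ N →
      step ⟨0, x⟩ M ≠ step ⟨i + 1, y⟩ N := by
    intro M N x i y hN hN' hy hx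
    have hex := exists_free_point hD hN hN' hy
    have hc := hex.choose_spec.2 _ hx
    have : step ⟨i + 1, y⟩ N = ⟨i, hex.choose, separator D i y hex.choose⟩ := by
      simp only [step]
      rw [dif_pos hex]
    rw [this]
    rcases zero_step x M with h | h <;> rw [h]
    · exact hc.1.symm
    · exact hc.2.symm
  obtain ⟨_ | i, x⟩ := r <;> obtain ⟨_ | j, y⟩ := s
  · obtain ⟨a, b⟩ := x
    obtain ⟨a', b'⟩ := y
    -- In a conflict both nodes move, by different amounts. Without one, a mover meets a halted node
    -- only if its amount is 0, and then it has not left `b ≠ b'`.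
    by_cases hb : b = b'
    · subst hb
      have ha : a ≠ a' := by
        rintro rfl
        exact hrs rfl
      simp only [step]
      rw [if_pos ⟨_, hsM, rfl⟩, if_pos ⟨_, hrN, rfl⟩]
      simpa [move] using fun h => absurd h ha
    · simp only [step]
      split_ifs with h1 h2 h2
      · simp only [move, ne_eq, Sigma.mk.injEq, heq_eq_eq, true_and, Prod.mk.injEq, not_and]
        rintro rfl h
        exact hb (add_right_cancel h)
      · simp only [move, halt, ne_eq, Sigma.mk.injEq, heq_eq_eq, true_and, Prod.mk.injEq, not_and]
        rintro rfl h
        exact hb (by simpa using h)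
      · simp only [move, halt, ne_eq, Sigma.mk.injEq, heq_eq_eq, true_and, Prod.mk.injEq, not_and]
        rintro rfl h
        exact hb (by simpa using h)
      · simpa [halt] using hb
  · exact mixed _ _ _ _ _ hN hN' hs hrN
  · exact (mixed _ _ _ _ _ hM hM' hr hsM).symm
  · by_cases hij : i = j
    · subst hij
      have hex := exists_free_point hD hM hM' hr
      have hex' := exists_free_point hD hN hN' hs
      simp only [step]
      rw [dif_pos hex, dif_pos hex']
      simp only [ne_eq, Sigma.mk.injEq, heq_eq_eq, true_and, Prod.mk.injEq, not_and]
      intro h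
      rw [← h]
      exact hex.choose_spec.1 y hsM
    · exact fun h => hij (congrArg Sigma.fst h)

/-- The colours after `t` steps on the network `H`. -/
noncomputable def run {V : Type} (D : ℕ) (H : SimpleGraph V) (ident : V → ℕ) :
    ℕ → V → LevelColor D
  | 0, v => init D (ident v)
  | t + 1, v => step (run D H ident t v) (run D H ident t '' H.neighborSet v)

/-! ### Properness and termination of the colour reduction -/

section Run

variable {V : Type} {H : SimpleGraph V} {ident : V → ℕ}

lemma run_fst (t : ℕ) (v : V) : (run D H ident t v).1 = (init D (ident v)).1 - t := by
  induction t with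
  | zero => rfl
  | succ t ih => rw [run, step_fst, ih, Nat.sub_sub]

lemma run_add_of_number {t : ℕ} {v : V} (h : (run D H ident t v).number.isSome) (n : ℕ) :
    run D H ident (t + n) v = run D H ident t v := by
  induction n with
  | zero => rfl
  | succ n ih => rw [← Nat.add_assoc, run, step_of_number, ih]; rwa [ih]

/-- A node that is not final for `n` steps at level `0` has moved `n` times. -/
lemma run_add_of_not_number {t n : ℕ} {v : V} {x} (h : run D H ident t v = ⟨0, x⟩)
    (hn : ¬ (run D H ident (t + n) v).number.isSome) :
    run D H ident (t + n) v = ⟨0, x.1, x.2 + n * x.1⟩ := by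
  induction n with
  | zero => simpa using h
  | succ n ih =>
    have hn' : ¬ (run D H ident (t + n) v).number.isSome := by
      intro h'
      apply hn
      rwa [← Nat.add_assoc, run_add_of_number h' 1]
    have ih := ih hn'
    rw [← Nat.add_assoc, run, ih] at hn ⊢
    simp only [step] at hn ⊢
    split_ifs at hn ⊢ with hc
    · simp [move]
      ring
    · simp [halt, number] at hn

variable [Finite V]

lemma ncard_image_neighborSet_le (hH : ∀ v, (H.neighborSet v).ncard ≤ D) (f : V → LevelColor D)
    (v : V) : (f '' H.neighborSet v).ncard ≤ D :=
  (Set.ncard_image_le (Set.toFinite _)).trans (hH v)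

lemma run_ne_run (hD : 0 < D) (hH : ∀ v, (H.neighborSet v).ncard ≤ D)
    (hid : Function.Injective ident) (t : ℕ) :
    ∀ {u v : V}, H.Adj u v → run D H ident t u ≠ run D H ident t v := by
  induction t with
  | zero => exact fun huv h => huv.ne (hid (init_injective hD h))
  | succ t ih =>
    intro u v huv
    have hmem : ∀ w, run D H ident t w ∉ run D H ident t '' H.neighborSet w := by
      rintro w ⟨x, hx, h⟩
      exact ih hx h.symm
    exact step_ne_step hD (Set.toFinite _) (ncard_image_neighborSet_le hH _ _) (Set.toFinite _)
      (ncard_image_neighborSet_le hH _ _) (hmem u) (hmem v) ⟨u, huv.symm, rfl⟩ ⟨v, huv, rfl⟩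

/-- At level `0` a node becomes final within `2 * D + 1` steps. -/
lemma number_run_isSome_of_level (hD : 0 < D) (hH : ∀ v, (H.neighborSet v).ncard ≤ D)
    (hid : Function.Injective ident) {t : ℕ} {v : V} (h : (run D H ident t v).1 = 0) :
    (run D H ident (t + (2 * D + 1)) v).number.isSome := by
  classical
  by_contra hcon
  obtain ⟨x, hx⟩ : ∃ x, run D H ident t v = ⟨0, x⟩ := by
    generalize run D H ident t v = s at h
    obtain ⟨j, x⟩ := s
    subst h
    exact ⟨x, rfl⟩
  have hnot : ∀ n ≤ 2 * D + 1, ¬ (run D H ident (t + n) v).number.isSome := by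
    intro n hn h'
    obtain ⟨k, hk⟩ := Nat.exists_eq_add_of_le hn
    apply hcon
    rw [hk, ← Nat.add_assoc, run_add_of_number h']
    exact h'
  have hv : ∀ n ≤ 2 * D + 1, run D H ident (t + n) v = ⟨0, x.1, x.2 + n * x.1⟩ :=
    fun n hn => run_add_of_not_number hx (hnot n hn)
  have hx1 : x.1 ≠ 0 := by
    intro h0
    apply hnot 0 (Nat.zero_le _)
    rw [hv 0 (Nat.zero_le _)]
    simp [number, h0]
  have hconf : ∀ n : Fin (2 * D + 1), ∃ u ∈ H.neighborSet v, ∃ a,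
      run D H ident (t + n) u = ⟨0, a, x.2 + (n : ℕ) * x.1⟩ := by
    intro n
    by_contra hno
    apply hnot (n + 1) n.2
    rw [← Nat.add_assoc, run, hv n n.2.le]
    simp only [step]
    rw [if_neg]
    · simp [halt, number]
    · rintro ⟨⟨a, b⟩, ⟨u, hu, hau⟩, rfl⟩
      exact hno ⟨u, hu, a, hau⟩
  choose u hu a ha using hconf
  have hfin : (H.neighborSet v).Finite := Set.toFinite _
  -- Each of the `2 * D + 1` conflicts is blamed on one of at most `D` neighbours, final or not; two
  -- conflicts share neighbour and status.
  obtain ⟨m, -, n, -, hmn, hf⟩ : ∃ m ∈ (Finset.univ : Finset (Fin (2 * D + 1))),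
      ∃ n ∈ (Finset.univ : Finset (Fin (2 * D + 1))), m ≠ n ∧
      (u m, decide (a m = 0)) = (u n, decide (a n = 0)) := by
    apply Finset.exists_ne_map_eq_of_card_lt_of_maps_to
      (t := hfin.toFinset ×ˢ (Finset.univ : Finset Bool))
    · rw [Finset.card_product, ← Set.ncard_eq_toFinset_card _ hfin]
      have := hH v
      simp
      omega
    · intro n _
      simp only [Finset.coe_product, Set.mem_prod, Finset.mem_coe, Set.Finite.mem_toFinset]
      exact ⟨hu n, Finset.mem_univ _⟩
  simp only [Prod.mk.injEq, decide_eq_decide] at hf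
  wlog hlt : m < n generalizing m n
  · exact this n m hmn.symm ⟨hf.1.symm, hf.2.symm⟩ (lt_of_le_of_ne (not_lt.1 hlt) hmn.symm)
  obtain ⟨k, hk⟩ := Nat.exists_eq_add_of_lt (Fin.lt_def.1 hlt)
  have hkp : ((k + 1 : ℕ) : ZMod (levelPrime D 0)) ≠ 0 := by
    rw [Ne, ZMod.natCast_eq_zero_iff]
    intro hdvd
    have := Nat.le_of_dvd (Nat.succ_pos _) hdvd
    have := (lt_levelPrime hD 0).1
    have := n.2
    omega
  have hm := ha m
  have hn := ha n
  rw [← hf.1, hk, Nat.add_assoc, ← Nat.add_assoc] at hn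
  -- A final neighbour stands still, so meeting it twice gives `(n - m) * x.1 = 0`, although `0 < n
  -- - m ≤ 2 * D < p`.
  by_cases h0 : a m = 0
  · rw [run_add_of_number (by rw [hm]; simp [number, h0]), hm] at hn
    simp only [Sigma.mk.injEq, heq_eq_eq, true_and, Prod.mk.injEq] at hn
    have h1 := hn.2
    push_cast at h1 hkp
    have h2 : ((k : ZMod (levelPrime D 0)) + 1) * x.1 = 0 := by linear_combination -h1
    rcases mul_eq_zero.1 h2 with h2 | h2
    · exact hkp h2
    · exact hx1 h2
  -- A neighbour not yet final moves by the constant amount `a m`. Two meetings force `a m = x.1`,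
  -- hence equal colours of adjacent nodes.
  · have h0' : a n ≠ 0 := fun h => h0 (hf.2.2 h)
    rw [run_add_of_not_number hm (by rw [hn]; simp [number, h0'])] at hn
    simp only [Sigma.mk.injEq, heq_eq_eq, true_and, Prod.mk.injEq] at hn
    have h1 := hn.2
    push_cast at h1 hkp
    have h2 : ((k : ZMod (levelPrime D 0)) + 1) * (a m - x.1) = 0 := by linear_combination h1
    rcases mul_eq_zero.1 h2 with h2 | h2
    · exact hkp h2
    · apply run_ne_run hD hH hid (t + m) (hu m)
      rw [hm, hv m m.2.le, sub_eq_zero.1 h2]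

/-- All nodes become final within `O(D + log* n)` steps. -/
theorem number_run_isSome (hD : 0 < D) (hH : ∀ v, (H.neighborSet v).ncard ≤ D)
    (hid : Function.Injective ident) {c n : ℕ} {v : V} (hc : ident v ≤ c * n ^ c) {t : ℕ}
    (ht : 2 * (logStar n + c + 2) + (2 * D + 1) ≤ t) :
    (run D H ident t v).number.isSome := by
  obtain ⟨k, rfl⟩ := Nat.exists_eq_add_of_le ht
  have h : (run D H ident (2 * (logStar n + c + 2)) v).1 = 0 := by
    rw [run_fst, Nat.sub_eq_zero_of_le (init_level_le hD hc)]
  have h' := number_run_isSome_of_level hD hH hid h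
  rwa [run_add_of_number h']

end Run

end LevelColor

/-! ### The greedy algorithm -/

lemma WithinTwo.symm {V : Type} {G : SimpleGraph V} {u v : V} (h : WithinTwo G u v) :
    WithinTwo G v u :=
  ⟨h.1.symm, h.2.imp SimpleGraph.Adj.symm fun ⟨x, hx, hy⟩ => ⟨x, hy.symm, hx.symm⟩⟩

lemma sum_biUnion_le {V : Type} [DecidableEq V] {f : V → ℚ} (hf : ∀ e, 0 ≤ f e) (S : Finset V) (N : V → Finset V) :
    ∑ e ∈ S.biUnion N, f e ≤ ∑ u ∈ S, ∑ e ∈ N u, f e := by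
  induction S using Finset.induction_on with
  | empty => simp
  | insert a S ha ih =>
    rw [Finset.biUnion_insert, Finset.sum_insert ha]
    have h := Finset.sum_union_inter (s₁ := N a) (s₂ := S.biUnion N) (f := f)
    have h' : 0 ≤ ∑ e ∈ N a ∩ S.biUnion N, f e := Finset.sum_nonneg fun e _ => hf e
    linarith

section GreedyTheory

variable {V : Type} [Fintype V] [DecidableEq V] {G : SimpleGraph V} [DecidableRel G.Adj]

lemma mem_closedNbhd {u v : V} : u ∈ closedNbhd G v ↔ u = v ∨ G.Adj v u := by
  simp [closedNbhd]

lemma self_mem_closedNbhd (v : V) : v ∈ closedNbhd G v := mem_closedNbhd.2 (Or.inl rfl)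

lemma mem_uncovered {D : Finset V} {v x : V} :
    x ∈ uncovered G D v ↔ x ∈ closedNbhd G v ∧ ∀ u ∈ D, x ∉ closedNbhd G u := by
  simp [uncovered]

lemma uncovered_anti {D D' : Finset V} (h : D ⊆ D') (v : V) :
    uncovered G D' v ⊆ uncovered G D v := by
  intro x hx
  rw [mem_uncovered] at hx ⊢
  exact ⟨hx.1, fun u hu => hx.2 u (h hu)⟩

lemma notMem_of_uncovered_nonempty {D : Finset V} {v : V} (h : (uncovered G D v).Nonempty) :
    v ∉ D := by
  obtain ⟨x, hx⟩ := h
  rw [mem_uncovered] at hx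
  exact fun hv => hx.2 v hv hx.1

lemma withinTwo_of_mem_closedNbhd {u v x : V} (hu : x ∈ closedNbhd G u) (hv : x ∈ closedNbhd G v)
    (h : u ≠ v) : WithinTwo G u v := by
  rw [mem_closedNbhd] at hu hv
  refine ⟨h, ?_⟩
  rcases hu with rfl | hu <;> rcases hv with rfl | hv
  · exact absurd rfl h
  · exact Or.inl hv.symm
  · exact Or.inl hu
  · exact Or.inr ⟨x, hu, hv.symm⟩

lemma card_closedNbhd_le (v : V) : (closedNbhd G v).card ≤ G.maxDegree + 1 :=
  (Finset.card_insert_le _ _).trans (Nat.add_le_add_right (G.degree_le_maxDegree v) 1)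

/-- There are at most `2 * Δ ^ 2` nodes within distance two. -/
lemma card_withinTwo_le (v : V) :
    (Finset.univ.filter fun u => WithinTwo G v u).card ≤ 2 * G.maxDegree ^ 2 := by
  have h : (Finset.univ.filter fun u => WithinTwo G v u) ⊆
      G.neighborFinset v ∪ (G.neighborFinset v).biUnion fun x => G.neighborFinset x := by
    intro u hu
    simp only [Finset.mem_filter, Finset.mem_univ, true_and] at hu
    simp only [Finset.mem_union, SimpleGraph.mem_neighborFinset, Finset.mem_biUnion]
    exact hu.2
  have h1 : (G.neighborFinset v).card ≤ G.maxDegree := G.degree_le_maxDegree v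
  have h2 : ((G.neighborFinset v).biUnion fun x => G.neighborFinset x).card ≤
      (G.neighborFinset v).card * G.maxDegree :=
    Finset.card_biUnion_le_card_mul _ _ _ fun x _ => G.degree_le_maxDegree x
  have h3 := (Finset.card_le_card h).trans (Finset.card_union_le _ _)
  nlinarith [Nat.mul_le_mul_right G.maxDegree h1, Nat.le_self_pow two_ne_zero G.maxDegree]

section Weights

variable {w : V → ℕ} {φ : V → ℕ}

lemma ineffectiveness_nonneg (D : Finset V) (v : V) : 0 ≤ ineffectiveness G w D v := by
  unfold ineffectiveness
  positivity

lemma ineffectiveness_mono {D D' : Finset V} (h : D ⊆ D') {v : V}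
    (hv : (uncovered G D' v).Nonempty) : ineffectiveness G w D v ≤ ineffectiveness G w D' v := by
  have h1 : 0 < (uncovered G D' v).card := hv.card_pos
  have h2 := Finset.card_le_card (uncovered_anti (G := G) h v)
  unfold ineffectiveness
  gcongr

lemma mem_localMinima {D : Finset V} {v : V} : v ∈ localMinima G w φ D ↔
    (uncovered G D v).Nonempty ∧
    ∀ u, WithinTwo G u v → (uncovered G D u).Nonempty → Precedes G w φ D v u := by
  simp [localMinima]

lemma Precedes.asymm {D : Finset V} {u v : V} (h : Precedes G w φ D u v) :
    ¬ Precedes G w φ D v u := by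
  rintro (h' | ⟨h', h''⟩) <;> rcases h with h | ⟨h, h'''⟩
  · exact lt_asymm h h'
  · exact h'.ne' h
  · exact h.ne' h'
  · exact lt_asymm h'' h'''

/-- The form needed both when `D` grows and when a single weight is raised: the key of the winner
stays, that of the loser may grow. -/
lemma Precedes.of_le {D D' : Finset V} {u v : V} {w' : V → ℕ} (h : Precedes G w φ D u v)
    (hu : ineffectiveness G w' D' u = ineffectiveness G w D u)
    (hv : ineffectiveness G w D v ≤ ineffectiveness G w' D' v) : Precedes G w' φ D' u v := by
  unfold Precedes at h ⊢
  rw [hu]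
  rcases h with h | ⟨h, hφ⟩
  · exact Or.inl (h.trans_le hv)
  · rw [h]
    rcases hv.lt_or_eq with h' | h'
    · exact Or.inl h'
    · exact Or.inr ⟨h', hφ⟩

/-- By antisymmetry of precedence `u` and `v` are not within distance two, so no node uncovered for
`v` is covered by `u`; competitors of `v` only become less effective. -/
lemma localMinima_insert {D : Finset V} {u v : V} (hu : u ∈ localMinima G w φ D)
    (hv : v ∈ localMinima G w φ D) (huv : u ≠ v) : v ∈ localMinima G w φ (insert u D) := by
  rw [mem_localMinima] at hu hv ⊢
  have hfar : ¬ WithinTwo G u v := fun h => (hv.2 u h hu.1).asymm (hu.2 v h.symm hv.1)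
  have heq : uncovered G (insert u D) v = uncovered G D v := by
    ext x
    simp only [mem_uncovered, Finset.forall_mem_insert]
    refine and_congr_right fun hx => and_iff_right fun hxu => ?_
    exact hfar (withinTwo_of_mem_closedNbhd hxu hx huv)
  rw [heq]
  refine ⟨hv.1, fun x hx hxa => ?_⟩
  refine (hv.2 x hx (hxa.mono (uncovered_anti (Finset.subset_insert u D) x))).of_le ?_
    (ineffectiveness_mono (Finset.subset_insert u D) hxa)
  unfold ineffectiveness
  rw [heq]

variable (G w φ) in
/-- One local minimum is selected. -/
def GreedyStep (D D' : Finset V) : Prop := ∃ v ∈ localMinima G w φ D, D' = insert v D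

variable (G w φ) in
/-- `D` is obtained from the empty set by selecting local minima one after the other. -/
def GreedyReachable (D : Finset V) : Prop := Relation.ReflTransGen (GreedyStep G w φ) ∅ D

/-- Simultaneous selection is serialised: the part of `A` already inserted keeps the other local
minima intact. -/
lemma greedyStep_union {A D : Finset V} (h : A ⊆ localMinima G w φ D) :
    Relation.ReflTransGen (GreedyStep G w φ) D (D ∪ A) ∧
      ∀ v ∈ localMinima G w φ D, v ∉ A → v ∈ localMinima G w φ (D ∪ A) := by
  induction A using Finset.induction_on with
  | empty => simpa using Relation.ReflTransGen.refl
  | insert a A ha ih =>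
    obtain ⟨h1, h2⟩ := ih ((Finset.subset_insert _ _).trans h)
    have ha' := h2 a (h (Finset.mem_insert_self _ _)) ha
    rw [Finset.union_insert]
    refine ⟨h1.tail ⟨a, ha', rfl⟩, fun v hv hvA => ?_⟩
    rw [Finset.mem_insert, not_or] at hvA
    exact localMinima_insert ha' (h2 v hv hvA.2) (Ne.symm hvA.1)

lemma GreedyReachable.union {A D : Finset V} (hD : GreedyReachable G w φ D)
    (h : A ⊆ localMinima G w φ D) : GreedyReachable G w φ (D ∪ A) :=
  Relation.ReflTransGen.trans hD (greedyStep_union h).1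

lemma eq_of_reflTransGen_greedyStep {D D' : Finset V} (hD : ∀ v, uncovered G D v = ∅)
    (h : Relation.ReflTransGen (GreedyStep G w φ) D D') : D' = D := by
  rcases h.cases_head with rfl | ⟨_, ⟨v, hv, -⟩, -⟩
  · rfl
  · rw [mem_localMinima, hD] at hv
    exact absurd hv.1 Finset.not_nonempty_empty

/-- The result of the greedy algorithm does not depend on the order of the selections. -/
lemma GreedyReachable.unique {D D' : Finset V} (h : GreedyReachable G w φ D)
    (h' : GreedyReachable G w φ D') (hD : ∀ v, uncovered G D v = ∅)
    (hD' : ∀ v, uncovered G D' v = ∅) : D = D' := by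
  have diamond : ∀ a b c, GreedyStep G w φ a b → GreedyStep G w φ a c →
      ∃ d, Relation.ReflGen (GreedyStep G w φ) b d ∧
        Relation.ReflTransGen (GreedyStep G w φ) c d := by
    rintro a _ _ ⟨u, hu, rfl⟩ ⟨v, hv, rfl⟩
    by_cases huv : u = v
    · subst huv
      exact ⟨_, .refl, .refl⟩
    · refine ⟨insert v (insert u a), .single ⟨v, localMinima_insert hu hv huv, rfl⟩,
        .single ⟨u, localMinima_insert hv hu (Ne.symm huv), ?_⟩⟩
      rw [Finset.insert_comm]
  obtain ⟨E, h1, h2⟩ := Relation.church_rosser diamond h h'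
  rw [← eq_of_reflTransGen_greedyStep hD h1, ← eq_of_reflTransGen_greedyStep hD' h2]

/-- The lexicographic minimum over all active nodes works; distinct colours make it strict within
distance two. -/
lemma exists_mem_localMinima (hφ : ∀ u v, WithinTwo G u v → φ u ≠ φ v) {D : Finset V} {v : V}
    (hv : (uncovered G D v).Nonempty) : ∃ u, u ∈ localMinima G w φ D := by
  obtain ⟨u, hu, hmin⟩ := Finset.exists_min_image
    (Finset.univ.filter fun v => (uncovered G D v).Nonempty)
    (fun v => toLex (ineffectiveness G w D v, φ v)) ⟨v, by simpa using hv⟩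
  simp only [Finset.mem_filter, Finset.mem_univ, true_and] at hu hmin
  refine ⟨u, mem_localMinima.2 ⟨hu, fun x hx hxa => ?_⟩⟩
  have hne : toLex (ineffectiveness G w D u, φ u) ≠ toLex (ineffectiveness G w D x, φ x) :=
    fun h => hφ x u hx (congrArg Prod.snd (toLex.injective h)).symm
  exact Prod.Lex.toLex_lt_toLex.1 (lt_of_le_of_ne (hmin x hxa) hne)

variable (G w φ) in
lemma greedyReachable_greedyDominatingSet :
    GreedyReachable G w φ (greedyDominatingSet G w φ) := by
  unfold greedyDominatingSet
  induction Fintype.card V with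
  | zero => exact .refl
  | succ n ih =>
    rw [Function.iterate_succ_apply']
    exact ih.union subset_rfl

/-- While some node is active every iteration adds a node; after `|V|` iterations all nodes would be
selected, contradicting activity. -/
lemma uncovered_greedyDominatingSet (hφ : ∀ u v, WithinTwo G u v → φ u ≠ φ v) (v : V) :
    uncovered G (greedyDominatingSet G w φ) v = ∅ := by
  by_contra hv
  rw [← Ne, ← Finset.nonempty_iff_ne_empty] at hv
  have key : ∀ n, (uncovered G ((fun D => D ∪ localMinima G w φ D)^[n] ∅) v).Nonempty →
      n ≤ ((fun D => D ∪ localMinima G w φ D)^[n] ∅).card := by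
    intro n
    induction n with
    | zero => exact fun _ => Nat.zero_le _
    | succ n ih =>
      rw [Function.iterate_succ_apply']
      intro h
      set D := (fun D => D ∪ localMinima G w φ D)^[n] ∅
      have h' := h.mono (uncovered_anti Finset.subset_union_left v)
      obtain ⟨u, hu⟩ := exists_mem_localMinima (w := w) hφ h'
      refine (Nat.succ_le_succ (ih h')).trans (Finset.card_lt_card ?_)
      refine Finset.ssubset_iff_subset_ne.2 ⟨Finset.subset_union_left, fun heq => ?_⟩
      apply notMem_of_uncovered_nonempty (mem_localMinima.1 hu).1
      rw [heq]
      exact Finset.mem_union_right _ hu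
  have h1 := key _ hv
  apply notMem_of_uncovered_nonempty hv
  unfold greedyDominatingSet
  rw [Finset.eq_univ_of_card _ (le_antisymm (Finset.card_le_univ _) h1)]
  exact Finset.mem_univ v

lemma isDominatingSet_of_uncovered {D : Finset V} (h : ∀ v, uncovered G D v = ∅) :
    IsDominatingSet G D := by
  intro v
  have hv : v ∉ uncovered G D v := by simp [h]
  rw [mem_uncovered] at hv
  push Not at hv
  obtain ⟨u, hu, hvu⟩ := hv (self_mem_closedNbhd v)
  rcases mem_closedNbhd.1 hvu with rfl | hadj
  · exact Or.inl hu
  · exact Or.inr ⟨u, hu, hadj⟩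

/-! ### Monotonicity -/

/-- If `v` were not selected under `w'`, the whole run under `w'` would also be a run under `w`,
where `v` competes less strongly. By uniqueness `v` would then be missing from the result for `w`.
-/
lemma mem_greedyDominatingSet_of_le (hφ : ∀ u v, WithinTwo G u v → φ u ≠ φ v) {w' : V → ℕ} {v : V}
    (hw : ∀ u, u ≠ v → w' u = w u) (hv : w' v ≤ w v) (h : v ∈ greedyDominatingSet G w φ) :
    v ∈ greedyDominatingSet G w' φ := by
  by_contra hcon
  have key : ∀ D, GreedyReachable G w' φ D → v ∉ D → GreedyReachable G w φ D := by
    intro D hD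
    induction hD with
    | refl => exact fun _ => .refl
    | tail hD hstep ih =>
      obtain ⟨u, hu, rfl⟩ := hstep
      intro hvD
      rw [Finset.mem_insert, not_or] at hvD
      refine (ih hvD.2).tail ⟨u, ?_, rfl⟩
      rw [mem_localMinima] at hu ⊢
      refine ⟨hu.1, fun x hx hxa => (hu.2 x hx hxa).of_le ?_ ?_⟩
      · unfold ineffectiveness
        rw [hw u (Ne.symm hvD.1)]
      · unfold ineffectiveness
        by_cases hxv : x = v
        · subst hxv
          gcongr
        · rw [hw x hxv]
  rw [GreedyReachable.unique (greedyReachable_greedyDominatingSet G w φ)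
    (key _ (greedyReachable_greedyDominatingSet G w' φ) hcon)
    (uncovered_greedyDominatingSet hφ) (uncovered_greedyDominatingSet hφ)] at h
  exact hcon h

/-! ### The approximation ratio -/

lemma harmonic_add_le {a m n : ℕ} (h : a + m ≤ n) : harmonic a + m * (n : ℚ)⁻¹ ≤ harmonic (a + m) := by
  induction m with
  | zero => simp
  | succ m ih =>
    have h1 := ih (by omega)
    have h2 : (n : ℚ)⁻¹ ≤ ((a + m + 1 : ℕ) : ℚ)⁻¹ := by
      gcongr
      omega
    rw [← Nat.add_assoc, harmonic_succ]
    push_cast at h2 ⊢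
    linarith

/-- The weight of the selected nodes can be charged to the covered nodes in such a way that no
closed neighbourhood pays more than a harmonic number times the weight of its centre. -/
lemma GreedyReachable.exists_price {D : Finset V} (h : GreedyReachable G w φ D) :
    ∃ price : V → ℚ, (∀ e, 0 ≤ price e) ∧ (∀ e, (∀ u ∈ D, e ∉ closedNbhd G u) → price e = 0) ∧
      ∑ v ∈ D, (w v : ℚ) = ∑ e, price e ∧
      ∀ u, ∑ e ∈ closedNbhd G u, price e ≤
        w u * (harmonic (closedNbhd G u).card - harmonic (uncovered G D u).card) := by
  induction h with
  | refl =>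
    refine ⟨0, by simp, by simp, by simp, fun u => ?_⟩
    have : uncovered G ∅ u = closedNbhd G u := by simp [uncovered]
    simp [this]
  | @tail D _ hD hstep ih =>
    obtain ⟨v, hv, rfl⟩ := hstep
    obtain ⟨price, hnn, hzero, hsum, hle⟩ := ih
    rw [mem_localMinima] at hv
    set r := ineffectiveness G w D v with hr
    have hr0 : 0 ≤ r := ineffectiveness_nonneg D v
    have hadd : ∀ S : Finset V, ∑ e ∈ S, (price e + if e ∈ uncovered G D v then r else 0) =
        ∑ e ∈ S, price e + (S ∩ uncovered G D v).card * r := by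
      intro S
      rw [Finset.sum_add_distrib, Finset.sum_ite_mem, Finset.sum_const, nsmul_eq_mul]
    -- Every newly covered node pays the ineffectiveness `r`, in total exactly `w v`.
    refine ⟨fun e => price e + if e ∈ uncovered G D v then r else 0, fun e => ?_, fun e he => ?_, ?_,
      fun u => ?_⟩
    · have := hnn e
      positivity
    · simp only [Finset.forall_mem_insert] at he
      beta_reduce
      rw [hzero e he.2, if_neg, add_zero]
      exact fun h => he.1 (mem_uncovered.1 h).1
    · rw [hadd, Finset.sum_insert (notMem_of_uncovered_nonempty hv.1), hsum, Finset.univ_inter, hr,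
        ineffectiveness, mul_div_cancel₀, add_comm]
      exact_mod_cast hv.1.card_pos.ne'
    · rw [hadd]
      have hinter : closedNbhd G u ∩ uncovered G D v = uncovered G D u ∩ closedNbhd G v := by
        ext x
        simp only [Finset.mem_inter, mem_uncovered]
        tauto
      have hdiff : uncovered G (insert v D) u = uncovered G D u \ closedNbhd G v := by
        ext x
        simp only [Finset.mem_sdiff, mem_uncovered, Finset.forall_mem_insert]
        tauto
      rw [hinter, hdiff]
      have hcard := Finset.card_sdiff_add_card_inter (uncovered G D u) (closedNbhd G v)
      have hu := hle u
      set n := (uncovered G D u).card with hn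
      set m := (uncovered G D u ∩ closedNbhd G v).card with hm
      set a := (uncovered G D u \ closedNbhd G v).card
      have hH := harmonic_add_le hcard.le
      rw [hcard] at hH
      -- If `N⁺(u)` contains a newly covered node, then `u` is active and equals `v` or is within
      -- distance two of it, so minimality gives `r ≤ w u / n`. The `m` payments are then bounded by
      -- `w u` times a difference of harmonic numbers.
      have hmr : m * r ≤ w u * (m * (n : ℚ)⁻¹) := by
        rcases Nat.eq_zero_or_pos m with h0 | hpos
        · simp [h0]
        · obtain ⟨x, hx⟩ := Finset.card_pos.1 hpos
          rw [Finset.mem_inter] at hx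
          have hr' : r ≤ w u * (n : ℚ)⁻¹ := by
            rw [← div_eq_mul_inv]
            by_cases huv : u = v
            · subst huv
              exact le_rfl
            · have := hv.2 u (withinTwo_of_mem_closedNbhd (mem_uncovered.1 hx.1).1 hx.2 huv)
                ⟨x, hx.1⟩
              rcases this with h | h
              · exact h.le
              · exact h.1.le
          calc (m : ℚ) * r ≤ m * (w u * (n : ℚ)⁻¹) := by gcongr
            _ = _ := by ring
      have hwu : (0 : ℚ) ≤ w u := Nat.cast_nonneg _
      nlinarith [mul_le_mul_of_nonneg_left hH hwu]

lemma harmonic_mono {a b : ℕ} (h : a ≤ b) : harmonic a ≤ harmonic b := by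
  obtain ⟨k, rfl⟩ := Nat.exists_eq_add_of_le h
  have := harmonic_add_le (le_refl (a + k))
  have h0 : (0 : ℚ) ≤ k * ((a + k : ℕ) : ℚ)⁻¹ := by positivity
  linarith

/-- The closed neighbourhoods of `D'` cover all nodes, so together they pay at least the weight of
`D`. -/
lemma GreedyReachable.isApproxMinDominatingSet {D : Finset V} (h : GreedyReachable G w φ D)
    (hD : ∀ v, uncovered G D v = ∅) :
    IsApproxMinDominatingSet G w (1 + Real.log ((G.maxDegree : ℝ) + 1)) D := by
  refine ⟨isDominatingSet_of_uncovered hD, fun D' hD' => ?_⟩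
  obtain ⟨price, hnn, -, hsum, hle⟩ := h.exists_price
  have h1 : ∑ v ∈ D, (w v : ℚ) ≤ harmonic (G.maxDegree + 1) * ∑ v ∈ D', (w v : ℚ) := by
    rw [hsum, Finset.mul_sum]
    calc ∑ e, price e ≤ ∑ e ∈ D'.biUnion (closedNbhd G), price e := by
          refine Finset.sum_le_sum_of_subset_of_nonneg (fun e _ => ?_) fun e _ _ => hnn e
          rw [Finset.mem_biUnion]
          rcases hD' e with he | ⟨u, hu, hue⟩
          · exact ⟨e, he, self_mem_closedNbhd e⟩
          · exact ⟨u, hu, mem_closedNbhd.2 (Or.inr hue)⟩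
      _ ≤ ∑ u ∈ D', ∑ e ∈ closedNbhd G u, price e :=
          sum_biUnion_le hnn _ _
      _ ≤ ∑ u ∈ D', harmonic (G.maxDegree + 1) * w u := by
          refine Finset.sum_le_sum fun u _ => (hle u).trans ?_
          rw [hD, Finset.card_empty, harmonic_zero, sub_zero, mul_comm]
          gcongr
          exact harmonic_mono (card_closedNbhd_le u)
  have h2 : ((harmonic (G.maxDegree + 1) : ℚ) : ℝ) ≤ 1 + Real.log ((G.maxDegree : ℝ) + 1) := by
    simpa using harmonic_le_one_add_log (G.maxDegree + 1)
  have h3 : ∑ v ∈ D, (w v : ℝ) ≤ ((harmonic (G.maxDegree + 1) : ℚ) : ℝ) * ∑ v ∈ D', (w v : ℝ) := by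
    exact_mod_cast h1
  refine h3.trans (mul_le_mul_of_nonneg_right h2 ?_)
  positivity

/-! ### The number of steps -/

variable (G w φ) in
/-- The key of a node: its ineffectiveness, ties being broken by its colour. -/
def greedyKey (D : Finset V) (v : V) : ℚ ×ₗ ℕ := toLex (ineffectiveness G w D v, φ v)

lemma greedyKey_mono {D D' : Finset V} (h : D ⊆ D') {v : V} (hv : (uncovered G D' v).Nonempty) :
    greedyKey G w φ D v ≤ greedyKey G w φ D' v :=
  Prod.Lex.toLex_mono ⟨ineffectiveness_mono h hv, le_rfl⟩

/-- A set of keys that contains the keys of all active nodes. -/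
def greedyKeys (W Δ Φ : ℕ) : Finset (ℚ ×ₗ ℕ) :=
  ((insert 0 ((Finset.Icc 1 W ×ˢ Finset.Icc 1 (Δ + 1)).image fun p => (p.1 : ℚ) / p.2)) ×ˢ
    Finset.range Φ).map toLex.toEmbedding

lemma card_greedyKeys_le (W Δ Φ : ℕ) : (greedyKeys W Δ Φ).card ≤ (W * (Δ + 1) + 1) * Φ := by
  rw [greedyKeys, Finset.card_map, Finset.card_product, Finset.card_range]
  refine Nat.mul_le_mul_right _ ((Finset.card_insert_le _ _).trans (Nat.add_le_add_right ?_ 1))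
  refine Finset.card_image_le.trans ?_
  simp

lemma greedyKey_mem {W Φ : ℕ} (hw : ∀ v, w v ≤ W) (hΦ : ∀ v, φ v < Φ) {D : Finset V} {v : V}
    (hv : (uncovered G D v).Nonempty) : greedyKey G w φ D v ∈ greedyKeys W G.maxDegree Φ := by
  rw [greedyKeys, Finset.mem_map]
  refine ⟨(ineffectiveness G w D v, φ v), ?_, rfl⟩
  rw [Finset.mem_product, Finset.mem_range, Finset.mem_insert, Finset.mem_image]
  refine ⟨?_, hΦ v⟩
  rcases Nat.eq_zero_or_pos (w v) with h0 | hpos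
  · left
    simp [ineffectiveness, h0]
  · right
    refine ⟨(w v, (uncovered G D v).card), ?_, rfl⟩
    have h1 : (uncovered G D v).card ≤ G.maxDegree + 1 :=
      (Finset.card_le_card Finset.sdiff_subset).trans (card_closedNbhd_le v)
    simp only [Finset.mem_product, Finset.mem_Icc]
    exact ⟨⟨hpos, hw v⟩, hv.card_pos, h1⟩

/-- A process that from time `T` on selects each active node whose key is smaller than the possibly
outdated keys of the active nodes within distance `2`: then all nodes are inactive after two steps
for each possible key. -/
lemma uncovered_eq_empty_of_progress {D : ℕ → Finset V} {T : ℕ} (hmono : ∀ t, D t ⊆ D (t + 1))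
    (hφ : ∀ u v, WithinTwo G u v → φ u ≠ φ v)
    (hstep : ∀ t, T ≤ t → ∀ v, (uncovered G (D (t + 1)) v).Nonempty →
      (∀ u, WithinTwo G u v → (uncovered G (D t) u).Nonempty →
        greedyKey G w φ (D (t + 1)) v < greedyKey G w φ (D t) u) → v ∈ D (t + 2))
    {W Φ : ℕ} (hw : ∀ v, w v ≤ W) (hΦ : ∀ v, φ v < Φ) (v : V) :
    uncovered G (D (T + 2 * ((W * (G.maxDegree + 1) + 1) * Φ))) v = ∅ := by
  have hmono' : Monotone D := monotone_nat_of_le_succ hmono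
  have key : ∀ n v, (uncovered G (D (T + 2 * n)) v).Nonempty →
      n ≤ ((greedyKeys W G.maxDegree Φ).filter (· < greedyKey G w φ (D (T + 2 * n)) v)).card := by
    intro n
    induction n with
    | zero => exact fun _ _ => Nat.zero_le _
    | succ n ih =>
      intro v hv
      rw [show T + 2 * (n + 1) = T + 2 * n + 2 by ring] at hv ⊢
      set t := T + 2 * n
      have hv1 := hv.mono (uncovered_anti (hmono (t + 1)) v)
      have hv0 := hv1.mono (uncovered_anti (hmono t) v)
      obtain ⟨u, hu, hmin⟩ := Finset.exists_min_image
        (Finset.univ.filter fun v => (uncovered G (D t) v).Nonempty)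
        (greedyKey G w φ (D t)) ⟨v, by simpa using hv0⟩
      simp only [Finset.mem_filter, Finset.mem_univ, true_and] at hu hmin
      -- Otherwise the key of `v` never exceeded the minimum at time `t`, and `v` would have been
      -- selected by `t + 2`; colours exclude ties.
      have hlt : greedyKey G w φ (D t) u < greedyKey G w φ (D (t + 2)) v := by
        by_contra hcon
        refine notMem_of_uncovered_nonempty hv (hstep t (Nat.le_add_right _ _) v hv1 fun x hx hxa => ?_)
        have h1 : greedyKey G w φ (D (t + 1)) v ≤ greedyKey G w φ (D t) x :=
          ((greedyKey_mono (hmono (t + 1)) hv).trans (not_lt.1 hcon)).trans (hmin x hxa)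
        refine lt_of_le_of_ne h1 fun h => hφ x v hx ?_
        exact (congrArg Prod.snd (toLex.injective h)).symm
      -- The old minimum has `n` keys below it and is itself one more key below that of `v`.
      refine (Nat.succ_le_succ (ih u hu)).trans (Finset.card_lt_card ?_)
      rw [Finset.ssubset_iff_of_subset]
      · refine ⟨greedyKey G w φ (D t) u, ?_, by simp⟩
        simpa using ⟨greedyKey_mem hw hΦ hu, hlt⟩
      · intro x hx
        rw [Finset.mem_filter] at hx ⊢
        exact ⟨hx.1, hx.2.trans hlt⟩
  by_contra hne
  have hv := Finset.nonempty_iff_ne_empty.2 hne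
  have h1 := key _ v hv
  have h2 : ((greedyKeys W G.maxDegree Φ).filter
      (· < greedyKey G w φ (D (T + 2 * ((W * (G.maxDegree + 1) + 1) * Φ))) v)).card <
      (greedyKeys W G.maxDegree Φ).card := by
    refine Finset.card_lt_card (Finset.filter_ssubset.2 ⟨_, greedyKey_mem hw hΦ hv, lt_irrefl _⟩)
  have h3 := card_greedyKeys_le W G.maxDegree Φ
  omega

/-- If there are no edges, then two steps suffice. -/
lemma uncovered_eq_empty_of_maxDegree_eq_zero {D : ℕ → Finset V} {T : ℕ}
    (hmono : ∀ t, D t ⊆ D (t + 1)) (hG : G.maxDegree = 0)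
    (hstep : ∀ t, T ≤ t → ∀ v, (uncovered G (D (t + 1)) v).Nonempty →
      (∀ u, WithinTwo G u v → (uncovered G (D t) u).Nonempty →
        greedyKey G w φ (D (t + 1)) v < greedyKey G w φ (D t) u) → v ∈ D (t + 2))
    (v : V) : uncovered G (D (T + 2)) v = ∅ := by
  by_contra hne
  have hv := Finset.nonempty_iff_ne_empty.2 hne
  refine notMem_of_uncovered_nonempty hv (hstep T le_rfl v (hv.mono (uncovered_anti (hmono _) v))
    fun u hu _ => ?_)
  have h := card_withinTwo_le (G := G) u
  rw [hG] at h
  have h' : v ∉ (Finset.univ.filter fun x => WithinTwo G u x) := by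
    rw [Finset.card_eq_zero.1 (Nat.le_zero.1 h)]
    exact Finset.notMem_empty v
  exact absurd (by simpa using hu) h'

end Weights

end GreedyTheory

/-! ### Threshold payments -/

open Classical in
/-- The outcome for an agent that bids `β` and would be selected for exactly the bids that satisfy
`s`: if it is selected, then it is paid the largest bid for which it would be selected. -/
noncomputable def thresholdOutput {W : ℕ} (s : Fin (W + 1) → Prop) (β : Fin (W + 1)) :
    NodeOutput :=
  ⟨decide (s β), if s β then (((Finset.univ.filter s).sup fun x => (x : ℕ) : ℕ) : ℝ) else 0⟩

/-- The threshold does not depend on the agent's own bid. A cost that wins is at most the threshold,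
so truth gives nonnegative utility; if the cost loses, monotonicity puts the threshold at or below
it, so winning cannot pay. -/
lemma totalUtility_thresholdOutput_le {W : ℕ} {s : Fin (W + 1) → Prop}
    (hs : ∀ x y, x ≤ y → s y → s x) (β x : Fin (W + 1)) :
    totalUtility (β : ℕ) (thresholdOutput s x) ≤ totalUtility (β : ℕ) (thresholdOutput s β) := by
  classical
  have hle : ∀ y, s y → (y : ℕ) ≤ (Finset.univ.filter s).sup fun x => (x : ℕ) := fun y hy =>
    Finset.le_sup (f := fun x : Fin (W + 1) => (x : ℕ)) (by simpa using hy)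
  simp only [totalUtility, thresholdOutput]
  by_cases hβ : s β <;> by_cases hx : s x <;> simp only [hβ, hx, if_true, if_false, decide_true,
    decide_false, Bool.false_eq_true, le_refl]
  · have : ((β : ℕ) : ℝ) ≤ (((Finset.univ.filter s).sup fun x => (x : ℕ) : ℕ) : ℝ) := by
      exact_mod_cast hle β hβ
    linarith
  · have hsup : (Finset.univ.filter s).sup (fun x => (x : ℕ)) ≤ (β : ℕ) := by
      refine Finset.sup_le fun y hy => ?_
      simp only [Finset.mem_filter, Finset.mem_univ, true_and] at hy
      by_contra hlt
      exact hβ (hs β y (Fin.le_def.2 (not_le.1 hlt).le) hy)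
    have : (((Finset.univ.filter s).sup fun x => (x : ℕ) : ℕ) : ℝ) ≤ ((β : ℕ) : ℝ) := by
      exact_mod_cast hsup
    linarith

/-! ### The mechanism as a two-hop dynamics -/

/-- The state of a node.  For each pair `κ = (i, x)` it takes part in an execution of the greedy
algorithm in which the bid of the node with identifier `i` is replaced by `x`. -/
@[ext]
structure AgentState (W : ℕ) where
  id : ℕ
  bid : Fin (W + 1)
  color : Option (Σ k : ℕ, LevelColor (2 ^ k))
  selected : ℕ × Fin (W + 1) → Prop
  /-- the number of uncovered nodes in the closed neighbourhood before the last step -/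
  count : ℕ × Fin (W + 1) → ℕ

namespace AgentState

variable {W : ℕ}

/-- The bid of the node in the execution `κ`. -/
def bidIn (s : AgentState W) (κ : ℕ × Fin (W + 1)) : ℕ := if s.id = κ.1 then κ.2 else s.bid

/-- The final colour of a node. -/
noncomputable def number (s : AgentState W) : Option ℕ := s.color.bind fun c => c.2.number

/-- A state is final if the colour is final and the node is inactive in all executions. -/
def IsFinal (s : AgentState W) : Prop := s.number.isSome ∧ ∀ κ, s.count κ = 0

/-- A node of state `s` whose neighbours have the states in `M` is covered in the execution `κ`. -/
def Covered (κ : ℕ × Fin (W + 1)) (s : AgentState W) (M : Set (AgentState W)) : Prop :=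
  s.selected κ ∨ ∃ r ∈ M, r.selected κ

/-- The states of the other nodes within distance two. -/
def others (s : AgentState W) (N : Set (AgentState W × Set (AgentState W))) :
    Set (AgentState W) :=
  {r | r.id ≠ s.id ∧ ∃ p ∈ N, r = p.1 ∨ r ∈ p.2}

/-- The new colour: at first the colour of the identifier, the degree bound being the power of two
that belongs to the number of nodes within distance two; then one step of the colour reduction among
the nodes with the same degree bound. -/
noncomputable def newColor (s : AgentState W) (N : Set (AgentState W × Set (AgentState W))) :
    Option (Σ k : ℕ, LevelColor (2 ^ k)) :=
  match s.color with
  | none => some ⟨Nat.clog 2 (s.others N).ncard, LevelColor.init _ s.id⟩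
  | some ⟨k, c⟩ => some ⟨k, c.step {c' | ∃ r ∈ s.others N, r.color = some ⟨k, c'⟩}⟩

open Classical in
/-- The number of uncovered nodes in the closed neighbourhood. -/
noncomputable def newCount (s : AgentState W) (N : Set (AgentState W × Set (AgentState W)))
    (κ : ℕ × Fin (W + 1)) : ℕ :=
  {p ∈ N | ¬ Covered κ p.1 p.2}.ncard + if Covered κ s (Prod.fst '' N) then 0 else 1

/-- A node is selected if all colours within distance two are final and its key is smaller than all
keys of other active nodes within distance two; the number of uncovered neighbours of the other nodes
is the one of the previous step. -/
def newSelected (s : AgentState W) (N : Set (AgentState W × Set (AgentState W)))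
    (κ : ℕ × Fin (W + 1)) : Prop :=
  s.selected κ ∨ ∃ c, s.number = some c ∧ 0 < s.newCount N κ ∧
    ∀ r ∈ s.others N, ∃ c', r.number = some c' ∧
      (0 < r.count κ → toLex ((s.bidIn κ : ℚ) / s.newCount N κ, c) <
        toLex ((r.bidIn κ : ℚ) / r.count κ, c'))

end AgentState

open Classical in
/-- The distributed greedy mechanism. -/
noncomputable def greedyDynamics (W : ℕ) : TwoHopDynamics (NodeInput W) NodeOutput where
  State := AgentState W
  -- The initial counts 0 have no effect: without a colour a state is not final, and no node can be
  -- selected.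
  start i := ⟨i.id, i.bid, none, fun _ => False, fun _ => 0⟩
  update s N := if s.IsFinal then s else
    ⟨s.id, s.bid, s.newColor N, s.newSelected N, s.newCount N⟩
  output s := if s.IsFinal then some (thresholdOutput (fun x => s.selected (s.id, x)) s.bid)
    else none
  output_start i := if_neg fun h => by simp [AgentState.IsFinal, AgentState.number] at h
  update_of_output s N h := if_pos (by by_contra hs; simp [hs] at h)

/-! ### The dynamics colours within distance two and counts uncovered nodes correctly -/

section Correctness

variable {V : Type} (G : SimpleGraph V)

/-- The exponent of the degree bound of a node in the graph of the pairs within distance two. -/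
noncomputable def degreeClass (v : V) : ℕ := Nat.clog 2 {u | WithinTwo G u v}.ncard

/-- The pairs of nodes of the degree class `k` that are within distance two. -/
def classGraph (k : ℕ) : SimpleGraph V where
  Adj u v := WithinTwo G u v ∧ degreeClass G u = k ∧ degreeClass G v = k
  symm := ⟨fun _ _ h => ⟨h.1.symm, h.2.2, h.2.1⟩⟩
  loopless := ⟨fun _ h => h.1.1 rfl⟩

/-- The colours of the nodes within their degree class after `t` steps. -/
noncomputable def classColor (ident : V → ℕ) (t : ℕ) (v : V) : LevelColor (2 ^ degreeClass G v) :=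
  LevelColor.run _ (classGraph G (degreeClass G v)) ident t v

/-- The final colouring, if all colours are final at time `t`. -/
noncomputable def finalColor (ident : V → ℕ) (t : ℕ) (v : V) : ℕ :=
  (classColor G ident t v).number.getD 0

variable {G} {ident : V → ℕ}

lemma two_pow_clog_le (m : ℕ) : 2 ^ Nat.clog 2 m ≤ 2 * m + 1 := by
  rcases Nat.lt_or_ge 1 m with h | h
  · have h1 := Nat.pow_pred_clog_lt_self one_lt_two h
    have h2 : 0 < Nat.clog 2 m := Nat.clog_pos one_lt_two h
    obtain ⟨k, hk⟩ := Nat.exists_eq_succ_of_ne_zero h2.ne'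
    rw [hk, Nat.pred_succ] at h1
    rw [hk, pow_succ]
    omega
  · rw [Nat.clog_of_right_le_one h]
    omega

variable (G ident) in
/-- The state of a node after `t` steps. -/
noncomputable def agentRun {W : ℕ} (b : V → Fin (W + 1)) (t : ℕ) (v : V) : AgentState W :=
  (greedyDynamics W).run G (fun v => ⟨ident v, b v⟩) t v

variable {W : ℕ} {b : V → Fin (W + 1)}

variable (G ident b) in
/-- What a node learns about the nodes within distance two. -/
def agentView (t : ℕ) (v : V) : Set (AgentState W × Set (AgentState W)) :=
  (fun u => (agentRun G ident b t u, agentRun G ident b t '' G.neighborSet u)) '' G.neighborSet v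

lemma agentRun_succ_of_isFinal {t : ℕ} {v : V} (h : (agentRun G ident b t v).IsFinal) :
    agentRun G ident b (t + 1) v = agentRun G ident b t v :=
  if_pos h

lemma agentRun_succ_of_not_isFinal {t : ℕ} {v : V} (h : ¬ (agentRun G ident b t v).IsFinal) :
    agentRun G ident b (t + 1) v = ⟨(agentRun G ident b t v).id, (agentRun G ident b t v).bid,
      (agentRun G ident b t v).newColor (agentView G ident b t v),
      (agentRun G ident b t v).newSelected (agentView G ident b t v),
      (agentRun G ident b t v).newCount (agentView G ident b t v)⟩ :=
  if_neg h

lemma agentRun_id_bid (t : ℕ) (v : V) :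
    (agentRun G ident b t v).id = ident v ∧ (agentRun G ident b t v).bid = b v := by
  induction t with
  | zero => exact ⟨rfl, rfl⟩
  | succ t ih =>
    by_cases h : (agentRun G ident b t v).IsFinal
    · rwa [agentRun_succ_of_isFinal h]
    · rwa [agentRun_succ_of_not_isFinal h]

/-- Views are sets of states; the identifiers inside keep different nodes apart, so cardinalities
count nodes. -/
lemma agentRun_injective (hid : Function.Injective ident) (t : ℕ) :
    Function.Injective (agentRun G ident b t) := by
  intro u v h
  apply hid
  rw [← (agentRun_id_bid (G := G) (ident := ident) (b := b) t u).1, h, (agentRun_id_bid t v).1]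

lemma others_agentView (hid : Function.Injective ident) (t : ℕ) (v : V) :
    (agentRun G ident b t v).others (agentView G ident b t v) =
      agentRun G ident b t '' {u | WithinTwo G u v} := by
  ext r
  constructor
  · rintro ⟨hr, _, ⟨u, hu, rfl⟩, rfl | ⟨x, hx, rfl⟩⟩
    · refine ⟨u, ⟨?_, Or.inl (SimpleGraph.Adj.symm hu)⟩, rfl⟩
      rintro rfl
      exact hr rfl
    · refine ⟨x, ⟨?_, Or.inr ⟨u, SimpleGraph.Adj.symm hx, SimpleGraph.Adj.symm hu⟩⟩, rfl⟩
      rintro rfl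
      exact hr rfl
  · rintro ⟨u, ⟨hne, h⟩, rfl⟩
    refine ⟨?_, ?_⟩
    · rw [(agentRun_id_bid (ident := ident) (b := b) t u).1,
        (agentRun_id_bid (ident := ident) (b := b) t v).1]
      exact fun h => hne (hid h)
    · rcases h with h | ⟨x, hux, hxv⟩
      · exact ⟨_, ⟨u, h.symm, rfl⟩, Or.inl rfl⟩
      · exact ⟨_, ⟨x, hxv.symm, rfl⟩, Or.inr ⟨u, hux.symm, rfl⟩⟩

lemma not_isFinal_zero (v : V) : ¬ (agentRun G ident b 0 v).IsFinal := by
  intro h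
  have := h.1
  simp [agentRun, TwoHopDynamics.run, greedyDynamics, AgentState.number] at this

/-- The first step is spent on finding the degree class, so the colouring lags by one. Freezing a
final state is harmless because its colour is a fixed point. -/
lemma agentRun_color (hid : Function.Injective ident) (t : ℕ) (v : V) :
    (agentRun G ident b (t + 1) v).color = some ⟨degreeClass G v, classColor G ident t v⟩ := by
  induction t generalizing v with
  | zero =>
    have h : ¬ (agentRun G ident b 0 v).IsFinal := fun h => by
      have := h.1
      simp [agentRun, TwoHopDynamics.run, greedyDynamics, AgentState.number] at this
    rw [agentRun_succ_of_not_isFinal h]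
    have hnone : (agentRun G ident b 0 v).color = none := rfl
    simp only [AgentState.newColor]
    rw [hnone]
    simp only
    rw [others_agentView hid, Set.ncard_image_of_injective _ (agentRun_injective hid 0)]
    rfl
  | succ t ih =>
    by_cases h : (agentRun G ident b (t + 1) v).IsFinal
    · rw [agentRun_succ_of_isFinal h, ih]
      have hnum := h.1
      rw [AgentState.number, ih] at hnum
      have : classColor G ident (t + 1) v = classColor G ident t v :=
        LevelColor.run_add_of_number hnum 1
      rw [this]
    · rw [agentRun_succ_of_not_isFinal h]
      simp only [AgentState.newColor]
      rw [ih]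
      simp only
      rw [others_agentView hid]
      have hset : {c' | ∃ r ∈ agentRun G ident b (t + 1) '' {u | WithinTwo G u v},
          r.color = some ⟨degreeClass G v, c'⟩} =
          LevelColor.run _ (classGraph G (degreeClass G v)) ident t ''
            (classGraph G (degreeClass G v)).neighborSet v := by
        ext c'
        constructor
        · rintro ⟨_, ⟨u, hu, rfl⟩, h⟩
          rw [ih] at h
          have hk : degreeClass G u = degreeClass G v :=
            congrArg Sigma.fst (Option.some.inj h)
          refine ⟨u, ⟨WithinTwo.symm hu, rfl, hk⟩, ?_⟩
          unfold classColor at h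
          generalize degreeClass G v = k at c' h hk ⊢
          subst hk
          simpa using h
        · rintro ⟨u, hu, rfl⟩
          refine ⟨_, ⟨u, hu.1.symm, rfl⟩, ?_⟩
          rw [ih]
          unfold classColor
          rw [hu.2.2]
      rw [hset]
      rfl

lemma bidIn_agentRun (κ : ℕ × Fin (W + 1)) (t : ℕ) (v : V) :
    (agentRun G ident b t v).bidIn κ = if ident v = κ.1 then (κ.2 : ℕ) else b v := by
  rw [AgentState.bidIn, (agentRun_id_bid t v).1, (agentRun_id_bid t v).2]

variable [Fintype V]

open Classical in
variable (G ident b) in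
/-- The nodes that are selected in the execution `κ` after `t` steps. -/
noncomputable def selectedIn (κ : ℕ × Fin (W + 1)) (t : ℕ) : Finset V :=
  Finset.univ.filter fun v => (agentRun G ident b t v).selected κ

lemma mem_selectedIn {κ : ℕ × Fin (W + 1)} {t : ℕ} {v : V} :
    v ∈ selectedIn G ident b κ t ↔ (agentRun G ident b t v).selected κ := by
  simp [selectedIn]

lemma selectedIn_subset_succ (κ : ℕ × Fin (W + 1)) (t : ℕ) :
    selectedIn G ident b κ t ⊆ selectedIn G ident b κ (t + 1) := by
  intro v hv
  rw [mem_selectedIn] at hv ⊢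
  by_cases h : (agentRun G ident b t v).IsFinal
  · rwa [agentRun_succ_of_isFinal h]
  · rw [agentRun_succ_of_not_isFinal h]
    exact Or.inl hv

/-- The rounded two-hop degree that defines the class also bounds degrees in it; nodes of other
classes are isolated. -/
lemma ncard_classGraph_le (k : ℕ) (v : V) : ((classGraph G k).neighborSet v).ncard ≤ 2 ^ k := by
  by_cases hk : degreeClass G v = k
  · subst hk
    refine (Set.ncard_le_ncard (t := {u | WithinTwo G u v}) (fun u hu => hu.1.symm)
      (Set.toFinite _)).trans ?_
    exact Nat.le_pow_clog one_lt_two _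
  · rw [(Set.ncard_eq_zero (Set.toFinite _)).2]
    · exact Nat.zero_le _
    · exact Set.eq_empty_of_forall_notMem fun u hu => hk hu.2.1

variable [DecidableEq V] [DecidableRel G.Adj]

lemma ncard_withinTwo_le (v : V) : {u | WithinTwo G u v}.ncard ≤ 2 * G.maxDegree ^ 2 := by
  classical
  refine le_trans (le_of_eq ?_) (card_withinTwo_le (G := G) v)
  rw [← Set.ncard_coe_finset]
  congr 1
  ext u
  simpa using ⟨WithinTwo.symm, WithinTwo.symm⟩

lemma two_pow_degreeClass_le (v : V) : 2 ^ degreeClass G v ≤ 4 * G.maxDegree ^ 2 + 1 := by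
  have h1 := two_pow_clog_le {u | WithinTwo G u v}.ncard
  have h2 := ncard_withinTwo_le (G := G) v
  unfold degreeClass
  omega

/-- A time after which all colours are final. -/
def colorTime (Δ c n : ℕ) : ℕ := 2 * (logStar n + c + 2) + (2 * (4 * Δ ^ 2 + 1) + 1)

lemma number_classColor (hid : Function.Injective ident) {c : ℕ}
    (hc : ∀ v, ident v ≤ c * Fintype.card V ^ c) {t : ℕ}
    (ht : colorTime G.maxDegree c (Fintype.card V) ≤ t) (v : V) :
    (classColor G ident t v).number =
      some (finalColor G ident (colorTime G.maxDegree c (Fintype.card V)) v) := by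
  obtain ⟨n, rfl⟩ := Nat.exists_eq_add_of_le ht
  have h := LevelColor.number_run_isSome (pow_pos two_pos _) (ncard_classGraph_le (G := G) _) hid
    (hc v) (t := colorTime G.maxDegree c (Fintype.card V)) (by
      have := two_pow_degreeClass_le (G := G) v
      unfold colorTime
      gcongr)
  unfold finalColor classColor
  rw [LevelColor.run_add_of_number h, ← Option.some_get h]
  rfl

lemma finalColor_lt (hid : Function.Injective ident) {c : ℕ}
    (hc : ∀ v, ident v ≤ c * Fintype.card V ^ c) (v : V) :
    finalColor G ident (colorTime G.maxDegree c (Fintype.card V)) v <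
      64 * (4 * G.maxDegree ^ 2 + 1) :=
  (LevelColor.number_bounds (pow_pos two_pos _) (number_classColor hid hc le_rfl v)).2.trans_le
    (Nat.mul_le_mul_left _ (two_pow_degreeClass_le v))

/-- Within a class the colouring is proper and numbering injective; different classes use disjoint
intervals `[32 * 2 ^ k, 64 * 2 ^ k)`. -/
lemma finalColor_ne (hid : Function.Injective ident) {c : ℕ}
    (hc : ∀ v, ident v ≤ c * Fintype.card V ^ c) (u v : V) (huv : WithinTwo G u v) :
    finalColor G ident (colorTime G.maxDegree c (Fintype.card V)) u ≠
      finalColor G ident (colorTime G.maxDegree c (Fintype.card V)) v := by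
  intro heq
  have hu := number_classColor (G := G) hid hc le_rfl u
  have hv := number_classColor (G := G) hid hc le_rfl v
  rw [← heq] at hv
  by_cases hk : degreeClass G u = degreeClass G v
  · unfold classColor at hu hv
    rw [← hk] at hv
    exact LevelColor.run_ne_run (pow_pos two_pos _) (ncard_classGraph_le (G := G) _) hid _
      (show (classGraph G (degreeClass G u)).Adj u v from ⟨huv, rfl, hk.symm⟩)
      (LevelColor.number_injOn hu hv)
  · have hu' := LevelColor.number_bounds (pow_pos two_pos _) hu
    have hv' := LevelColor.number_bounds (pow_pos two_pos _) hv
    rcases Nat.lt_or_gt_of_ne hk with h | h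
    · have := Nat.pow_le_pow_right two_pos (Nat.succ_le_of_lt h)
      rw [Nat.pow_succ] at this
      omega
    · have := Nat.pow_le_pow_right two_pos (Nat.succ_le_of_lt h)
      rw [Nat.pow_succ] at this
      omega

lemma covered_agentRun (κ : ℕ × Fin (W + 1)) (t : ℕ) (v : V) :
    AgentState.Covered κ (agentRun G ident b t v) (agentRun G ident b t '' G.neighborSet v) ↔
      ∃ u ∈ selectedIn G ident b κ t, v ∈ closedNbhd G u := by
  constructor
  · rintro (h | ⟨_, ⟨u, hu, rfl⟩, h⟩)
    · exact ⟨v, mem_selectedIn.2 h, self_mem_closedNbhd v⟩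
    · exact ⟨u, mem_selectedIn.2 h, mem_closedNbhd.2 (Or.inr (SimpleGraph.Adj.symm hu))⟩
  · rintro ⟨u, hu, hv⟩
    rcases mem_closedNbhd.1 hv with rfl | h
    · exact Or.inl (mem_selectedIn.1 hu)
    · exact Or.inr ⟨_, ⟨u, h.symm, rfl⟩, mem_selectedIn.1 hu⟩

lemma newCount_agentRun (hid : Function.Injective ident) (κ : ℕ × Fin (W + 1)) (t : ℕ) (v : V) :
    (agentRun G ident b t v).newCount (agentView G ident b t v) κ =
      (uncovered G (selectedIn G ident b κ t) v).card := by
  classical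
  set D := selectedIn G ident b κ t with hD
  have hun : uncovered G D v =
      (closedNbhd G v).filter fun x => ¬ ∃ u ∈ D, x ∈ closedNbhd G u := by
    ext x
    simp [mem_uncovered]
  have hfst : Prod.fst '' agentView G ident b t v = agentRun G ident b t '' G.neighborSet v := by
    rw [agentView, Set.image_image]
  have hset : {p ∈ agentView G ident b t v | ¬ AgentState.Covered κ p.1 p.2} =
      (fun u => (agentRun G ident b t u, agentRun G ident b t '' G.neighborSet u)) ''
        ((G.neighborFinset v).filter fun x => ¬ ∃ u ∈ D, x ∈ closedNbhd G u : Finset V) := by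
    ext p
    constructor
    · rintro ⟨⟨u, hu, rfl⟩, hp⟩
      rw [covered_agentRun] at hp
      refine ⟨u, ?_, rfl⟩
      rw [Finset.mem_coe, Finset.mem_filter]
      exact ⟨by simpa using hu, hp⟩
    · rintro ⟨u, hu, rfl⟩
      rw [Finset.mem_coe, Finset.mem_filter] at hu
      refine ⟨⟨u, by simpa using hu.1, rfl⟩, ?_⟩
      rw [covered_agentRun]
      exact hu.2
  have hinj : Function.Injective
      fun u => (agentRun G ident b t u, agentRun G ident b t '' G.neighborSet u) :=
    fun u u' h => agentRun_injective hid t (congrArg Prod.fst h)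
  unfold AgentState.newCount
  rw [hfst, hset, Set.ncard_image_of_injective _ hinj, Set.ncard_coe_finset, hun, closedNbhd,
    Finset.filter_insert]
  have hcov := covered_agentRun (G := G) (ident := ident) (b := b) κ t v
  by_cases h : ∃ u ∈ D, v ∈ closedNbhd G u
  · rw [if_pos (hcov.2 h), if_neg (not_not.2 h), add_zero]
  · rw [if_neg (fun h' => h (hcov.1 h')), if_pos h, Finset.card_insert_of_notMem (by simp)]

/-- The stored count is one step old. In a frozen state it is 0, which remains right because
uncovered sets only shrink. -/
lemma agentRun_count (hid : Function.Injective ident) (κ : ℕ × Fin (W + 1)) (t : ℕ) (v : V) :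
    (agentRun G ident b (t + 1) v).count κ = (uncovered G (selectedIn G ident b κ t) v).card := by
  induction t with
  | zero =>
    rw [agentRun_succ_of_not_isFinal (not_isFinal_zero v)]
    exact newCount_agentRun hid κ 0 v
  | succ t ih =>
    by_cases h : (agentRun G ident b (t + 1) v).IsFinal
    · rw [agentRun_succ_of_isFinal h, h.2 κ]
      have h0 := h.2 κ
      rw [ih] at h0
      exact (Nat.le_zero.1 (h0 ▸ Finset.card_le_card
        (uncovered_anti (selectedIn_subset_succ κ t) v))).symm
    · rw [agentRun_succ_of_not_isFinal h]
      exact newCount_agentRun hid κ (t + 1) v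

lemma uncovered_of_isFinal (hid : Function.Injective ident) (κ : ℕ × Fin (W + 1)) {t : ℕ} {v : V}
    (h : (agentRun G ident b t v).IsFinal) : uncovered G (selectedIn G ident b κ t) v = ∅ := by
  rw [← Finset.card_eq_zero, ← agentRun_count hid, agentRun_succ_of_isFinal h, h.2]

lemma mem_selectedIn_succ (hid : Function.Injective ident) {κ : ℕ × Fin (W + 1)} {t : ℕ} {v : V} :
    v ∈ selectedIn G ident b κ (t + 1) ↔ v ∈ selectedIn G ident b κ t ∨
      ∃ c, (agentRun G ident b t v).number = some c ∧
        (uncovered G (selectedIn G ident b κ t) v).Nonempty ∧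
        ∀ u, WithinTwo G u v → ∃ c', (agentRun G ident b t u).number = some c' ∧
          (0 < (agentRun G ident b t u).count κ →
            toLex (((if ident v = κ.1 then (κ.2 : ℕ) else b v : ℕ) : ℚ) /
              (uncovered G (selectedIn G ident b κ t) v).card, c) <
            toLex (((if ident u = κ.1 then (κ.2 : ℕ) else b u : ℕ) : ℚ) /
              (agentRun G ident b t u).count κ, c')) := by
  by_cases h : (agentRun G ident b t v).IsFinal
  · rw [mem_selectedIn, agentRun_succ_of_isFinal h, mem_selectedIn, uncovered_of_isFinal hid κ h]
    simp
  · rw [mem_selectedIn, agentRun_succ_of_not_isFinal h, mem_selectedIn]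
    simp only [AgentState.newSelected]
    rw [newCount_agentRun hid, others_agentView hid, Finset.card_pos, bidIn_agentRun]
    simp only [Set.forall_mem_image, bidIn_agentRun]
    rfl

/-! ### Each simulated execution is a greedy run that ends in time -/

section Execution

variable {c : ℕ}

/-- A colour that is final early already equals the tie-breaking colour. The part `t ≠ 0` guarantees
that stored counts are genuine. -/
lemma agentRun_number (hid : Function.Injective ident)
    (hc : ∀ v, ident v ≤ c * Fintype.card V ^ c) {t : ℕ} {v : V} :
    ((agentRun G ident b t v).number.isSome → t ≠ 0 ∧ (agentRun G ident b t v).number =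
      some (finalColor G ident (colorTime G.maxDegree c (Fintype.card V)) v)) ∧
    (colorTime G.maxDegree c (Fintype.card V) < t → (agentRun G ident b t v).number =
      some (finalColor G ident (colorTime G.maxDegree c (Fintype.card V)) v)) := by
  rcases t with _ | t
  · refine ⟨fun h => ?_, fun h => absurd h (Nat.not_lt_zero _)⟩
    simp [agentRun, TwoHopDynamics.run, greedyDynamics, AgentState.number] at h
  · have hnum : (agentRun G ident b (t + 1) v).number = (classColor G ident t v).number := by
      rw [AgentState.number, agentRun_color hid]
      rfl
    rw [hnum]
    refine ⟨fun h => ⟨t.succ_ne_zero, ?_⟩, fun h =>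
      number_classColor hid hc (Nat.lt_succ_iff.1 h) v⟩
    have h1 := number_classColor (G := G) hid hc
      (Nat.le_add_left (colorTime G.maxDegree c (Fintype.card V)) t) v
    unfold classColor at h h1 ⊢
    rwa [LevelColor.run_add_of_number h] at h1

variable (G ident c) in
/-- The colouring that breaks ties. -/
noncomputable def tieBreaker (v : V) : ℕ :=
  finalColor G ident (colorTime G.maxDegree c (Fintype.card V)) v

variable (ident b) in
/-- The bids in the execution `κ`. -/
def bidsIn (κ : ℕ × Fin (W + 1)) (v : V) : ℕ := if ident v = κ.1 then (κ.2 : ℕ) else b v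

/-- Outdated counts are safe: a competitor active now was active one step earlier, and its old key
is a lower bound for its present key. -/
lemma selectedIn_sdiff_subset (hid : Function.Injective ident)
    (hc : ∀ v, ident v ≤ c * Fintype.card V ^ c) (κ : ℕ × Fin (W + 1)) (t : ℕ) :
    selectedIn G ident b κ (t + 1) \ selectedIn G ident b κ t ⊆
      localMinima G (bidsIn ident b κ) (tieBreaker G ident c) (selectedIn G ident b κ t) := by
  intro v hv
  rw [Finset.mem_sdiff, mem_selectedIn_succ hid] at hv
  obtain ⟨k, hk, hact, hmin⟩ := hv.1.resolve_left hv.2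
  obtain ⟨ht, hk'⟩ := (agentRun_number hid hc).1 (Option.isSome_of_mem hk)
  obtain rfl := Option.some.inj (hk.symm.trans hk')
  refine mem_localMinima.2 ⟨hact, fun u hu hua => ?_⟩
  obtain ⟨k', hk', hlt⟩ := hmin u hu
  obtain ⟨-, hk''⟩ := (agentRun_number hid hc).1 (Option.isSome_of_mem hk')
  obtain rfl := Option.some.inj (hk'.symm.trans hk'')
  obtain ⟨t, rfl⟩ := Nat.exists_eq_succ_of_ne_zero ht
  have hmono := selectedIn_subset_succ (G := G) (ident := ident) (b := b) κ t
  rw [Nat.succ_eq_add_one, agentRun_count hid] at hlt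
  have h1 := hlt (hua.mono (uncovered_anti hmono u)).card_pos
  exact Prod.Lex.toLex_lt_toLex.1 (h1.trans_le
    (greedyKey_mono (w := bidsIn ident b κ) (φ := tieBreaker G ident c) hmono hua))

lemma greedyReachable_selectedIn (hid : Function.Injective ident)
    (hc : ∀ v, ident v ≤ c * Fintype.card V ^ c) (κ : ℕ × Fin (W + 1)) (t : ℕ) :
    GreedyReachable G (bidsIn ident b κ) (tieBreaker G ident c) (selectedIn G ident b κ t) := by
  induction t with
  | zero =>
    have : selectedIn G ident b κ 0 = ∅ :=
      Finset.eq_empty_of_forall_notMem fun v hv => mem_selectedIn.1 hv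
    rw [this]
    exact .refl
  | succ t ih =>
    have := ih.union (selectedIn_sdiff_subset hid hc κ t)
    rwa [Finset.union_sdiff_of_subset (selectedIn_subset_succ κ t)] at this

/-- The hypothesis of `uncovered_eq_empty_of_progress`; own key at `t + 1` against foreign keys at
`t` is the comparison that the nodes make. -/
lemma selectedIn_progress (hid : Function.Injective ident)
    (hc : ∀ v, ident v ≤ c * Fintype.card V ^ c) (κ : ℕ × Fin (W + 1)) (t : ℕ)
    (ht : colorTime G.maxDegree c (Fintype.card V) ≤ t) (v : V)
    (hv : (uncovered G (selectedIn G ident b κ (t + 1)) v).Nonempty)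
    (hmin : ∀ u, WithinTwo G u v → (uncovered G (selectedIn G ident b κ t) u).Nonempty →
      greedyKey G (bidsIn ident b κ) (tieBreaker G ident c) (selectedIn G ident b κ (t + 1)) v <
      greedyKey G (bidsIn ident b κ) (tieBreaker G ident c) (selectedIn G ident b κ t) u) :
    v ∈ selectedIn G ident b κ (t + 2) := by
  refine (mem_selectedIn_succ hid).2 (Or.inr ⟨_, (agentRun_number hid hc).2 (by omega), hv,
    fun u hu => ⟨_, (agentRun_number hid hc).2 (by omega), fun hpos => ?_⟩⟩)
  rw [agentRun_count hid] at hpos ⊢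
  exact hmin u hu (Finset.card_pos.1 hpos)

/-- The number of steps until all nodes are inactive. -/
def greedyTime (W Δ c n : ℕ) : ℕ :=
  -- For Δ = 0 the general bound still grows with `W`, while the allowed term `Δ ^ 3 * W` vanishes.
  colorTime Δ c n + if Δ = 0 then 2 else 2 * ((W * (Δ + 1) + 1) * (64 * (4 * Δ ^ 2 + 1)))

lemma uncovered_selectedIn (hid : Function.Injective ident)
    (hc : ∀ v, ident v ≤ c * Fintype.card V ^ c) (κ : ℕ × Fin (W + 1)) (v : V) :
    uncovered G (selectedIn G ident b κ
      (greedyTime W G.maxDegree c (Fintype.card V))) v = ∅ := by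
  unfold greedyTime
  split_ifs with h
  · exact uncovered_eq_empty_of_maxDegree_eq_zero (selectedIn_subset_succ κ) h
      (selectedIn_progress hid hc κ) v
  · refine uncovered_eq_empty_of_progress (selectedIn_subset_succ κ) (finalColor_ne hid hc)
      (selectedIn_progress hid hc κ) (fun v => ?_) (finalColor_lt hid hc) v
    unfold bidsIn
    split_ifs <;> omega

variable (G ident c) in
/-- The mechanism that the algorithm implements. -/
noncomputable def greedyMechanism (b : V → Fin (W + 1)) (v : V) : NodeOutput :=
  thresholdOutput (fun x => v ∈ greedyDominatingSet G
    (fun u => (Function.update b v x u : ℕ)) (tieBreaker G ident c)) (b v)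

/-- The execution `(ident v, x)` is a greedy run on `Function.update b v x`, so the simulated
threshold is the true one. The additional step lets the lagging counts reach 0. -/
lemma output_agentRun (hid : Function.Injective ident)
    (hc : ∀ v, ident v ≤ c * Fintype.card V ^ c) (v : V) :
    (greedyDynamics W).output ((greedyDynamics W).run G (fun v => ⟨ident v, b v⟩)
      (greedyTime W G.maxDegree c (Fintype.card V) + 1) v) =
    some (greedyMechanism G ident c b v) := by
  set T := greedyTime W G.maxDegree c (Fintype.card V) with hT
  have hfin : (agentRun G ident b (T + 1) v).IsFinal := by
    refine ⟨?_, fun κ => ?_⟩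
    · rw [(agentRun_number hid hc).2]
      · rfl
      · rw [hT]
        unfold greedyTime
        omega
    · rw [agentRun_count hid, uncovered_selectedIn hid hc, Finset.card_empty]
  refine (if_pos hfin).trans (congrArg some ?_)
  change thresholdOutput (fun x => (agentRun G ident b (T + 1) v).selected
    ((agentRun G ident b (T + 1) v).id, x)) (agentRun G ident b (T + 1) v).bid = _
  rw [(agentRun_id_bid _ v).1, (agentRun_id_bid _ v).2, greedyMechanism]
  congr 1
  funext x
  rw [← mem_selectedIn]
  have hbids : bidsIn ident b (ident v, x) = fun u => (Function.update b v x u : ℕ) := by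
    funext u
    unfold bidsIn
    by_cases huv : u = v
    · subst huv
      simp
    · rw [if_neg (fun h => huv (hid h)), Function.update_of_ne huv]
  rw [← hbids, GreedyReachable.unique (greedyReachable_selectedIn hid hc _ _)
    (greedyReachable_greedyDominatingSet G _ (tieBreaker G ident c))
    (fun u => Finset.subset_empty.1 ((uncovered_anti (selectedIn_subset_succ _ T) u).trans
      (uncovered_selectedIn hid hc _ u).subset))
    (uncovered_greedyDominatingSet (finalColor_ne hid hc))]

lemma selectedSet_greedyMechanism (b : V → Fin (W + 1)) :
    selectedSet (greedyMechanism G ident c b) =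
      greedyDominatingSet G (fun v => (b v : ℕ)) (tieBreaker G ident c) := by
  ext v
  simp [selectedSet, greedyMechanism, thresholdOutput]

lemma greedyDominatingSet_update_antitone (hid : Function.Injective ident)
    (hc : ∀ v, ident v ≤ c * Fintype.card V ^ c) (b : V → Fin (W + 1)) (v : V)
    (x y : Fin (W + 1)) (hxy : x ≤ y)
    (h : v ∈ greedyDominatingSet G (fun u => (Function.update b v y u : ℕ))
      (tieBreaker G ident c)) :
    v ∈ greedyDominatingSet G (fun u => (Function.update b v x u : ℕ)) (tieBreaker G ident c) := by
  refine mem_greedyDominatingSet_of_le (finalColor_ne hid hc) (fun u hu => ?_) ?_ h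
  · rw [Function.update_of_ne hu, Function.update_of_ne hu]
  · simpa using hxy

lemma isTruthful_greedyMechanism (hid : Function.Injective ident)
    (hc : ∀ v, ident v ≤ c * Fintype.card V ^ c) :
    IsTruthful (greedyMechanism G ident c : (V → Fin (W + 1)) → V → NodeOutput) := by
  intro b v x
  have := totalUtility_thresholdOutput_le
    (greedyDominatingSet_update_antitone (G := G) hid hc b v) (b v) x
  simpa [greedyMechanism] using this

lemma isMonotoneMechanism_greedyMechanism (hid : Function.Injective ident)
    (hc : ∀ v, ident v ≤ c * Fintype.card V ^ c) :
    IsMonotoneMechanism (greedyMechanism G ident c : (V → Fin (W + 1)) → V → NodeOutput) := by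
  intro b v x hx h
  have := greedyDominatingSet_update_antitone (G := G) hid hc b v x (b v) hx
  simp only [greedyMechanism, thresholdOutput, decide_eq_true_eq] at h ⊢
  simpa using this h

lemma isApprox_greedyMechanism (hid : Function.Injective ident)
    (hc : ∀ v, ident v ≤ c * Fintype.card V ^ c) (b : V → Fin (W + 1)) :
    IsApproxMinDominatingSet G (fun v => (b v : ℕ)) (1 + Real.log ((G.maxDegree : ℝ) + 1))
      (selectedSet (greedyMechanism G ident c b)) := by
  rw [selectedSet_greedyMechanism]
  exact (greedyReachable_greedyDominatingSet G _ _).isApproxMinDominatingSet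
    (uncovered_greedyDominatingSet (finalColor_ne hid hc))

end Execution

end Correctness

/-- The main term is `2 * 2 * 960 = 3840` times `Δ ^ 3 * W`, with `960 = 3 * 64 * 5`; `W ≥ 1` lets
this term absorb the Δ² of the colouring, and `4 * c` comes from the starting levels. -/
lemma greedyTime_le {W : ℕ} (hW : 1 ≤ W) (Δ c n : ℕ) :
    2 * (greedyTime W Δ c n + 1) + 1 ≤ (4 * c + 5000) * (Δ ^ 3 * W + max 1 (logStar n)) := by
  have h1 : 1 ≤ max 1 (logStar n) := le_max_left _ _
  have h2 : logStar n ≤ max 1 (logStar n) := le_max_right _ _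
  set M := max 1 (logStar n)
  unfold greedyTime colorTime
  split_ifs with h
  · subst h
    have : 4 * c ≤ 4 * c * M := Nat.le_mul_of_pos_right _ h1
    simp only [ne_eq, OfNat.ofNat_ne_zero, not_false_eq_true, zero_pow, mul_zero, zero_mul, zero_add]
    linarith
  · have hΔ : 1 ≤ Δ := Nat.one_le_iff_ne_zero.2 h
    have h3 : 1 ≤ Δ ^ 2 := Nat.one_le_pow _ _ hΔ
    have h4 : Δ ^ 2 ≤ Δ ^ 3 * W := by
      calc Δ ^ 2 = Δ ^ 2 * 1 := (mul_one _).symm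
        _ ≤ Δ ^ 2 * (Δ * W) := Nat.mul_le_mul_left _ (Nat.mul_pos hΔ hW)
        _ = Δ ^ 3 * W := by ring
    have h5 : W * (Δ + 1) + 1 ≤ 3 * (W * Δ) := by
      have : 1 ≤ W * Δ := Nat.mul_pos hW hΔ
      have : W ≤ W * Δ := Nat.le_mul_of_pos_right _ hΔ
      linarith
    have h6 : (W * (Δ + 1) + 1) * (64 * (4 * Δ ^ 2 + 1)) ≤ 960 * (Δ ^ 3 * W) := by
      calc _ ≤ 3 * (W * Δ) * (64 * (5 * Δ ^ 2)) := by
            gcongr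
            linarith
        _ = 960 * (Δ ^ 3 * W) := by ring
    have h7 : 4 * c ≤ 4 * c * (Δ ^ 3 * W + M) := Nat.le_mul_of_pos_right _ (by omega)
    linarith

/-- If all weights are `0`, then every node is selected. -/
def selectAll : LocalAlgorithm (NodeInput 0) NodeOutput where
  State := Unit
  Message := Unit
  start _ := ()
  send _ := ()
  receive _ _ := ()
  output _ := some ⟨true, 0⟩
  stopped _ _ _ := rfl

/-- The algorithm for weights up to `W`. -/
noncomputable def greedyAlgorithm : (W : ℕ) → LocalAlgorithm (NodeInput W) NodeOutput
  | 0 => selectAll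
  | W + 1 => (greedyDynamics (W + 1)).toLocalAlgorithm

theorem theorem6p1 :
    -- one algorithm for each `W`; nodes know neither `n` nor `Δ` nor the bound on the identifiers
    ∃ A : (W : ℕ) → LocalAlgorithm (NodeInput W) NodeOutput,
      -- identifiers are polynomially bounded: at most `c * n ^ c`
      ∀ c : ℕ, ∃ C : ℕ,
        ∀ (W : ℕ) (V : Type) [Fintype V] [DecidableEq V] (G : SimpleGraph V) [DecidableRel G.Adj]
          (ident : V → ℕ), Function.Injective ident →
          (∀ v, ident v ≤ c * Fintype.card V ^ c) →
          ∃ mech : (V → Fin (W + 1)) → V → NodeOutput,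
            -- the mechanism is implemented by the algorithm, with the claimed running time
            (∀ b : V → Fin (W + 1),
              (A W).ComputesWithin G (fun v => ⟨ident v, b v⟩)
                (C * (G.maxDegree ^ 3 * W + max 1 (logStar (Fintype.card V)))) (mech b)) ∧
            IsTruthful mech ∧
            (∀ b : V → Fin (W + 1),
              IsApproxMinDominatingSet G (fun v => (b v : ℕ))
                (1 + Real.log ((G.maxDegree : ℝ) + 1)) (selectedSet (mech b))) ∧
            -- the allocation is monotone, and it is the one of the greedy algorithm
            IsMonotoneMechanism mech ∧
            (1 ≤ W → ∃ φ : V → ℕ, (∀ u v, WithinTwo G u v → φ u ≠ φ v) ∧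
              ∀ b : V → Fin (W + 1),
                selectedSet (mech b) = greedyDominatingSet G (fun v => (b v : ℕ)) φ) := by

  refine ⟨greedyAlgorithm, fun c => ⟨4 * c + 5000, ?_⟩⟩
  intro W V _ _ G _ ident hid hc
  rcases W with _ | W
  -- For `W = 0` the time bound has no room for the Δ² steps of colouring, but all sets cost 0, so
  -- selecting everything is optimal.
  · refine ⟨fun _ _ => ⟨true, 0⟩, fun b v => rfl, fun b v x => le_rfl, fun b => ⟨fun v => ?_,
      fun D' _ => ?_⟩, fun _ _ _ _ h => h, fun h => absurd h (by omega)⟩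
    · exact Or.inl (by simp [selectedSet])
    · simp
  · refine ⟨greedyMechanism G ident c, fun b => ?_, isTruthful_greedyMechanism hid hc,
      isApprox_greedyMechanism hid hc, isMonotoneMechanism_greedyMechanism hid hc, fun _ =>
      ⟨tieBreaker G ident c, finalColor_ne hid hc, selectedSet_greedyMechanism⟩⟩
    exact TwoHopDynamics.computesWithin_toLocalAlgorithm (output_agentRun hid hc)
      (greedyTime_le (Nat.succ_pos W) _ _ _)
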